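/- **Theorem 1.2.** Let $d\ge 1$ be an integer, $0<\alpha<d$, and let $(\lambda_n)_{n\ge 1}$ and $\lambda$ be real numbers with $2^{-d/\alpha}\le\lambda_n\le\lambda<\tfrac12$ for all $n\ge1$. Put $s_0=1$ and $s_n=\lambda_1\cdots\lambda_n$. Let $\mathcal D_0=\{[0,1]^d\}$ and, inductively, let $\mathcal D_{n+1}$ consist of all the cubes of side length $s_{n+1}$, with sides parallel to the axes, that are contained in a cube $Q\in\mathcal D_n$ and share a vertex with $Q$; thus $\mathcal D_n$ consists of $2^{dn}$ disjoint cubes of side length $s_n$. Let $K=\bigcap_{n}\bigcup_{Q\in\mathcal D_n}Q\subset\mathbb R^d$, let $\mu$ be the Borel probability measure on $K$ with $\mu(Q)=2^{-dn}$ for every $Q\in\mathcal D_n$ and every $n$, and let $a_n=2^{-dn}s_n^{-\alpha}$. Suppose that $a_n\to0$ as $n\to\infty$, and let $E$ be the set of points $x\in K$ for which the principal value $$\lim_{\varepsilon\to0^+}\int_{|y-x|>\varepsilon}\frac{y-x}{|y-x|^{1+\alpha}}\,d\mu(y)$$ exists in $\mathbb R^d$. Then the Hausdorff dimension of $E$ is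 at least $\alpha$. In particular, if $K$ has Hausdorff dimension $\alpha$, then $E$ has Hausdorff dimension exactly $\alpha$. -/

import Mathlib

open Filter Topology MeasureTheory

noncomputable section

namespace CantorPV

/-- The side length `s_n = λ_1 ⋯ λ_n` of the cubes of generation `n` (`s_0 = 1`). -/
def side (lam : ℕ → ℝ) (n : ℕ) : ℝ := ∏ k ∈ Finset.Icc 1 n, lam k

/-- The closed axis-parallel cube with lower corner `c` and side length `s`. -/
def cube {d : ℕ} (c : EuclideanSpace ℝ (Fin d)) (s : ℝ) : Set (EuclideanSpace ℝ (Fin d)) :=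
  {y | ∀ i, y i ∈ Set.Icc (c i) (c i + s)}

/-- The lower corners of the cubes of generation `n`.  A cube of generation `n` with lower corner
`c` has side `s_n`; the `2 ^ d` cubes of side `s_{n+1}` inside it that share a vertex with it are
those whose lower corner has each coordinate equal to `c i` or to `c i + (s_n - s_{n+1})`. -/
def corners (d : ℕ) (lam : ℕ → ℝ) : ℕ → Set (EuclideanSpace ℝ (Fin d))
  | 0 => {0}
  | n + 1 => {y | ∃ c ∈ corners d lam n, ∃ v : Fin d → Bool,
      ∀ i, y i = c i + if v i then side lam n - side lam (n + 1) else 0}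

/-- The family `𝓓_n` of the cubes of generation `n`; generation `0` is the unit cube. -/
def generation (d : ℕ) (lam : ℕ → ℝ) (n : ℕ) : Set (Set (EuclideanSpace ℝ (Fin d))) :=
  {Q | ∃ c ∈ corners d lam n, Q = cube c (side lam n)}

/-- The Cantor set: the points that lie in a cube of each generation. -/
def cantorSet (d : ℕ) (lam : ℕ → ℝ) : Set (EuclideanSpace ℝ (Fin d)) :=
  ⋂ n : ℕ, ⋃ Q ∈ generation d lam n, Q

/-- The point of the Cantor set reached by choosing, inside the current cube of generation `n`,
the corner cube in direction `ω n ∈ {0,1}^d`. -/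
def coding (d : ℕ) (lam : ℕ → ℝ) (ω : ℕ → Fin d → Bool) : EuclideanSpace ℝ (Fin d) :=
  WithLp.toLp 2 fun i => ∑' n, if ω n i then side lam n - side lam (n + 1) else 0

/-- The natural measure on the Cantor set: the law of the point obtained by choosing at each
generation one of the `2 ^ d` corner cubes uniformly and independently.  By `cantorMeasure_cube`
and `cantorMeasure_compl` below it is carried by the Cantor set and gives each cube of
generation `n` the mass `2 ^ (-d n)`. -/
def cantorMeasure (d : ℕ) (lam : ℕ → ℝ) : Measure (EuclideanSpace ℝ (Fin d)) :=
  (Measure.infinitePi fun _ : ℕ => (PMF.uniformOfFintype (Fin d → Bool)).toMeasure).map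
    (coding d lam)

/-- The `α`-density `a_n = 2 ^ (-d n) s_n ^ (-α)` at generation `n`. -/
def density (d : ℕ) (α : ℝ) (lam : ℕ → ℝ) (n : ℕ) : ℝ :=
  ((2 : ℝ) ^ (d * n))⁻¹ * side lam n ^ (-α)

/-- The `α`-Riesz kernel `x / |x| ^ (1 + α)`. -/
def rieszKernel {d : ℕ} (α : ℝ) (x : EuclideanSpace ℝ (Fin d)) : EuclideanSpace ℝ (Fin d) :=
  (‖x‖ ^ (1 + α))⁻¹ • x

/-- The truncated `α`-Riesz transform of `μ` at `x`: the integral of the kernel over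
`|y - x| > ε`. -/
def truncatedRiesz {d : ℕ} (α : ℝ) (μ : Measure (EuclideanSpace ℝ (Fin d))) (ε : ℝ)
    (x : EuclideanSpace ℝ (Fin d)) : EuclideanSpace ℝ (Fin d) :=
  ∫ y in {y | ε < ‖y - x‖}, rieszKernel α (y - x) ∂μ

/-- The principal value of the `α`-Riesz transform of `μ` exists at `x`. -/
def HasPrincipalValue {d : ℕ} (α : ℝ) (μ : Measure (EuclideanSpace ℝ (Fin d)))
    (x : EuclideanSpace ℝ (Fin d)) : Prop :=
  ∃ L : EuclideanSpace ℝ (Fin d),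
    Tendsto (fun ε : ℝ => truncatedRiesz α μ ε x) (𝓝[>] 0) (𝓝 L)

/-! ### The natural measure has the properties that characterize it -/

lemma side_succ (lam : ℕ → ℝ) (n : ℕ) : side lam (n + 1) = side lam n * lam (n + 1) := by
  simp [side, Finset.prod_Icc_succ_top]

lemma side_zero (lam : ℕ → ℝ) : side lam 0 = 1 := by simp [side]

lemma side_pos {lam : ℕ → ℝ} (h : ∀ n, 1 ≤ n → 0 < lam n ∧ lam n < 1 / 2) (n : ℕ) :
    0 < side lam n :=
  Finset.prod_pos fun k hk => (h k (Finset.mem_Icc.1 hk).1).1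

lemma two_mul_side_succ_lt {lam : ℕ → ℝ} (h : ∀ n, 1 ≤ n → 0 < lam n ∧ lam n < 1 / 2) (n : ℕ) :
    2 * side lam (n + 1) < side lam n := by
  have h1 := side_pos h n
  have h2 := (h (n + 1) (by omega)).2
  rw [side_succ]
  nlinarith

lemma side_tendsto {lam : ℕ → ℝ} (h : ∀ n, 1 ≤ n → 0 < lam n ∧ lam n < 1 / 2) :
    Tendsto (side lam) atTop (𝓝 0) := by
  have hle : ∀ n, side lam n ≤ (1 / 2 : ℝ) ^ n := by
    intro n
    induction n with
    | zero => simp [side_zero]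
    | succ n ih =>
      have := two_mul_side_succ_lt h n
      rw [pow_succ]
      linarith
  exact squeeze_zero (fun n => (side_pos h n).le) hle
    (tendsto_pow_atTop_nhds_zero_of_lt_one (by norm_num) (by norm_num))

/-- The telescoping series of the gaps. -/
lemma hasSum_gap {lam : ℕ → ℝ} (h : ∀ n, 1 ≤ n → 0 < lam n ∧ lam n < 1 / 2) (m : ℕ) :
    HasSum (fun n => side lam (n + m) - side lam (n + m + 1)) (side lam m) := by
  rw [hasSum_iff_tendsto_nat_of_nonneg]
  · have : ∀ n, ∑ i ∈ Finset.range n, (side lam (i + m) - side lam (i + m + 1))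
        = side lam m - side lam (n + m) := by
      intro n
      have := Finset.sum_range_sub' (fun i => side lam (i + m)) n
      simp only [zero_add] at this
      rw [← this]
      refine Finset.sum_congr rfl fun i _ => ?_
      rw [show i + m + 1 = i + 1 + m by omega]
    simp only [this]
    have h0 := (side_tendsto h).comp (tendsto_add_atTop_nat m)
    simpa using tendsto_const_nhds.sub h0
  · intro n
    have := two_mul_side_succ_lt h (n + m)
    have := side_pos h (n + m + 1)
    linarith

/-- The lower corner of the cube of generation `n` with address `ω 0, …, ω (n-1)`. -/
def wordCorner (d : ℕ) (lam : ℕ → ℝ) (ω : ℕ → Fin d → Bool) (n : ℕ) :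
    EuclideanSpace ℝ (Fin d) :=
  WithLp.toLp 2 fun i =>
    ∑ k ∈ Finset.range n, if ω k i then side lam k - side lam (k + 1) else 0

lemma wordCorner_mem (d : ℕ) (lam : ℕ → ℝ) (ω : ℕ → Fin d → Bool) (n : ℕ) :
    wordCorner d lam ω n ∈ corners d lam n := by
  induction n with
  | zero =>
    change _ = _
    ext i
    simp [wordCorner]
  | succ n ih =>
    refine ⟨_, ih, ω n, fun i => ?_⟩
    simp [wordCorner, Finset.sum_range_succ]

lemma exists_word {d : ℕ} {lam : ℕ → ℝ} (n : ℕ) {c : EuclideanSpace ℝ (Fin d)}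
    (hc : c ∈ corners d lam n) : ∃ ω, c = wordCorner d lam ω n := by
  induction n generalizing c with
  | zero =>
    refine ⟨fun _ _ => false, ?_⟩
    have hc' : c = 0 := hc
    subst hc'
    ext i
    simp [wordCorner]
  | succ n ih =>
    obtain ⟨c', hc', v, hv⟩ := hc
    obtain ⟨ω, rfl⟩ := ih hc'
    refine ⟨fun k => if k = n then v else ω k, ?_⟩
    ext i
    rw [hv i]
    simp only [wordCorner, Finset.sum_range_succ, if_true]
    congr 1
    refine Finset.sum_congr rfl fun k hk => ?_
    simp [(Finset.mem_range.1 hk).ne]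

lemma coding_mem {lam : ℕ → ℝ} (h : ∀ n, 1 ≤ n → 0 < lam n ∧ lam n < 1 / 2) {d : ℕ}
    (ω : ℕ → Fin d → Bool) (n : ℕ) :
    coding d lam ω ∈ cube (wordCorner d lam ω n) (side lam n) := by
  intro i
  have hgap : ∀ k, 0 ≤ side lam k - side lam (k + 1) := fun k => by
    have := two_mul_side_succ_lt h k
    have := side_pos h (k + 1)
    linarith
  have hs : Summable fun k => if ω k i then side lam k - side lam (k + 1) else 0 := by
    refine Summable.of_nonneg_of_le (fun k => ?_) (fun k => ?_) (hasSum_gap h 0).summable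
    · split_ifs
      exacts [hgap k, le_rfl]
    · split_ifs
      exacts [le_rfl, hgap k]
  have hsplit := hs.sum_add_tsum_nat_add n
  have hs' := (summable_nat_add_iff n).2 hs
  have h0 : 0 ≤ ∑' k, if ω (k + n) i then side lam (k + n) - side lam (k + n + 1) else 0 := by
    refine tsum_nonneg fun k => ?_
    split_ifs
    exacts [hgap _, le_rfl]
  have h1 : (∑' k, if ω (k + n) i then side lam (k + n) - side lam (k + n + 1) else 0)
      ≤ side lam n := by
    rw [← (hasSum_gap h n).tsum_eq]
    refine hs'.tsum_le_tsum (fun k => ?_) (hasSum_gap h n).summable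
    split_ifs
    exacts [le_rfl, hgap _]
  simp only [coding, wordCorner, Set.mem_Icc]
  rw [← hsplit]
  constructor <;> linarith

lemma cube_anti {lam : ℕ → ℝ} (h : ∀ n, 1 ≤ n → 0 < lam n ∧ lam n < 1 / 2) {d : ℕ}
    (ω : ℕ → Fin d → Bool) (n : ℕ) :
    cube (wordCorner d lam ω (n + 1)) (side lam (n + 1))
      ⊆ cube (wordCorner d lam ω n) (side lam n) := by
  intro y hy i
  have hyi := hy i
  have h1 := two_mul_side_succ_lt h n
  have h2 := side_pos h (n + 1)
  simp only [wordCorner, Finset.sum_range_succ, Set.mem_Icc] at hyi ⊢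
  split_ifs at hyi <;> constructor <;> linarith [hyi.1, hyi.2]

/-- Cubes of the same generation that meet have the same address. -/
lemma eq_of_mem_cubes {lam : ℕ → ℝ} (h : ∀ n, 1 ≤ n → 0 < lam n ∧ lam n < 1 / 2) {d : ℕ}
    (ω ω' : ℕ → Fin d → Bool) (y : EuclideanSpace ℝ (Fin d)) (n : ℕ)
    (hy : y ∈ cube (wordCorner d lam ω n) (side lam n))
    (hy' : y ∈ cube (wordCorner d lam ω' n) (side lam n)) : ∀ k < n, ω k = ω' k := by
  induction n with
  | zero => simp
  | succ n ih =>
    have hpre := ih (cube_anti h ω n hy) (cube_anti h ω' n hy')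
    intro k hk
    rcases Nat.lt_succ_iff_lt_or_eq.1 hk with hk | rfl
    · exact hpre k hk
    · funext i
      have a1 := hy i
      have a2 := hy' i
      have h1 := two_mul_side_succ_lt h k
      have heq : ∑ j ∈ Finset.range k, (if ω j i then side lam j - side lam (j + 1) else 0)
          = ∑ j ∈ Finset.range k, (if ω' j i then side lam j - side lam (j + 1) else 0) :=
        Finset.sum_congr rfl fun j hj => by rw [hpre j (Finset.mem_range.1 hj)]
      simp only [wordCorner, Finset.sum_range_succ, Set.mem_Icc] at a1 a2
      rw [heq] at a1
      cases hb : ω k i <;> cases hb' : ω' k i <;> simp [hb, hb'] at a1 a2 ⊢ <;>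
        linarith [a1.1, a1.2, a2.1, a2.2]

lemma measurable_coding {lam : ℕ → ℝ} (h : ∀ n, 1 ≤ n → 0 < lam n ∧ lam n < 1 / 2) (d : ℕ) :
    Measurable (coding d lam) := by
  have hgap : ∀ k, 0 ≤ side lam k - side lam (k + 1) := fun k => by
    have := two_mul_side_succ_lt h k
    have := side_pos h (k + 1)
    linarith
  have hc : Continuous (coding d lam) := by
    refine (PiLp.continuous_toLp 2 _).comp (continuous_pi fun i => ?_)
    refine continuous_tsum (u := fun k => side lam k - side lam (k + 1)) (fun k => ?_)
      (hasSum_gap h 0).summable (fun k ω => ?_)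
    · exact (continuous_of_discreteTopology
        (f := fun b : Bool => if b then side lam k - side lam (k + 1) else 0)).comp
        ((continuous_apply i).comp (continuous_apply k))
    · split_ifs
      · rw [Real.norm_of_nonneg (hgap k)]
      · simpa using hgap k
  exact hc.measurable

lemma measurableSet_cube {d : ℕ} (c : EuclideanSpace ℝ (Fin d)) (s : ℝ) :
    MeasurableSet (cube c s) := by
  have : cube c s = ⋂ i, {y | y i ∈ Set.Icc (c i) (c i + s)} := by
    ext y
    simp [cube]
  rw [this]
  exact MeasurableSet.iInter fun i =>
    (by fun_prop : Measurable fun y : EuclideanSpace ℝ (Fin d) => y i) measurableSet_Icc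

lemma isProbabilityMeasure_cantorMeasure {lam : ℕ → ℝ}
    (h : ∀ n, 1 ≤ n → 0 < lam n ∧ lam n < 1 / 2) (d : ℕ) :
    IsProbabilityMeasure (cantorMeasure d lam) :=
  Measure.isProbabilityMeasure_map (measurable_coding h d).aemeasurable

/-- Each cube of generation `n` has mass `2 ^ (-d n)`. -/
theorem cantorMeasure_cube {lam : ℕ → ℝ} (h : ∀ n, 1 ≤ n → 0 < lam n ∧ lam n < 1 / 2) (d n : ℕ)
    {Q : Set (EuclideanSpace ℝ (Fin d))} (hQ : Q ∈ generation d lam n) :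
    cantorMeasure d lam Q = ((2 : ENNReal) ^ (d * n))⁻¹ := by
  obtain ⟨c, hc, rfl⟩ := hQ
  obtain ⟨w, rfl⟩ := exists_word n hc
  rw [cantorMeasure, Measure.map_apply (measurable_coding h d) (measurableSet_cube _ _)]
  have hpre : coding d lam ⁻¹' cube (wordCorner d lam w n) (side lam n)
      = Set.pi (Finset.range n : Set ℕ) fun k => {w k} := by
    ext ω
    simp only [Set.mem_preimage, Set.mem_pi, Finset.coe_range, Set.mem_Iio, Set.mem_singleton_iff]
    constructor
    · intro hω
      exact eq_of_mem_cubes h ω w _ n (coding_mem h ω n) hω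
    · intro hω
      have : wordCorner d lam w n = wordCorner d lam ω n := by
        ext i
        simp only [wordCorner]
        exact Finset.sum_congr rfl fun k hk => by rw [hω k (Finset.mem_range.1 hk)]
      rw [this]
      exact coding_mem h ω n
  rw [hpre, Measure.infinitePi_pi _ (fun k _ => measurableSet_singleton _)]
  simp only [PMF.toMeasure_apply_singleton _ _ (measurableSet_singleton _),
    PMF.uniformOfFintype_apply, Finset.prod_const, Finset.card_range]
  rw [← ENNReal.inv_pow]
  simp [pow_mul]

lemma finite_corners (d : ℕ) (lam : ℕ → ℝ) (n : ℕ) : (corners d lam n).Finite := by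
  induction n with
  | zero => exact Set.finite_singleton _
  | succ n ih =>
    refine ((ih.prod (Set.finite_univ (α := Fin d → Bool))).image fun p =>
      (WithLp.toLp 2 fun i => p.1 i + if p.2 i then side lam n - side lam (n + 1) else 0 :
        EuclideanSpace ℝ (Fin d))).subset ?_
    rintro y ⟨c, hc, v, hv⟩
    refine ⟨(c, v), ⟨hc, Set.mem_univ _⟩, ?_⟩
    ext i
    exact (hv i).symm

/-- The natural measure is carried by the Cantor set. -/
theorem cantorMeasure_compl {lam : ℕ → ℝ} (h : ∀ n, 1 ≤ n → 0 < lam n ∧ lam n < 1 / 2) (d : ℕ) :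
    cantorMeasure d lam (cantorSet d lam)ᶜ = 0 := by
  have hm : MeasurableSet (cantorSet d lam) := by
    refine MeasurableSet.iInter fun n => ?_
    have : (⋃ Q ∈ generation d lam n, Q) = ⋃ c ∈ corners d lam n, cube c (side lam n) := by
      ext y
      simp only [generation, Set.mem_iUnion, Set.mem_ofPred_eq, exists_prop]
      constructor
      · rintro ⟨_, ⟨c, hc, rfl⟩, hy⟩
        exact ⟨c, hc, hy⟩
      · rintro ⟨c, hc, hy⟩
        exact ⟨_, ⟨c, hc, rfl⟩, hy⟩
    rw [this]
    exact MeasurableSet.biUnion (finite_corners d lam n).countable fun c _ =>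
      measurableSet_cube _ _
  rw [cantorMeasure, Measure.map_apply (measurable_coding h d) hm.compl]
  have : coding d lam ⁻¹' (cantorSet d lam)ᶜ = ∅ := by
    rw [Set.eq_empty_iff_forall_notMem]
    intro ω hω
    refine hω (Set.mem_iInter.2 fun n => ?_)
    exact Set.mem_biUnion ⟨_, wordCorner_mem d lam ω n, rfl⟩ (coding_mem h ω n)
  rw [this, measure_empty]

end CantorPV

end

/-!
The principal value at a point `x` of the Cantor set exists as soon as the integrals of the kernel
over the complements of the cubes of generation `n` containing `x` converge as `n → ∞`, because
the separation of the cubes makes a truncation at a ball differ from a truncation at a cube by a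
bounded number of densities (`hasPrincipalValue_of_tendsto_shellRiesz`).  So it suffices to find a
subset of dimension close to `α` on which these integrals converge.

Two properties of the integrals are used, coordinate by coordinate.  The contribution of the
levels in a block `[n, m)`, taken at the centre of the cube of generation `m`, changes sign when
all the digits of the `i`-th coordinate in the block are reversed, and the other coordinates of
the integral do not notice this (`shellRiesz_flipFrom`).  And a run of equal digits in `[n, q)`
contributes a definite multiple of the sum of the densities over the run, up to a multiple of one
density (`le_shellRiesz_of_run`).

Divide the levels into blocks of a fixed length `L`.  In each block begin with a run of length `M`,
reverse the remaining free digits so that their contribution has the sign of that of the run, and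
reverse the whole block so that the total opposes the integral accumulated so far (`steer`).  The
only other change is that of the base point of the earlier levels, which costs a multiple of a
geometrically weighted average `b_n` of the densities (`abs_shellRiesz_sub_le_halfAverage`).  If
`M` is large, the run outweighs this error, unless the densities drop so much over the run that
`b` is halved over the block.  In both cases the potential formed by the modulus of the
accumulated integral and a multiple of `b_n` decreases by at least `b_n` or is of order `b_n`
(`exists_potential`).  If the `b_n` at the starts of the blocks have an infinite sum, the potential
tends to `0`, and so do the integrals; otherwise the densities are summable, and the integrals
converge absolutely (`exists_tendsto_shellRiesz_steered`).

Steering determines `M + 1` of the `L` digits in a block and leaves the others free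
(`eq_xor_steer`), so the natural measure of the steered branches gives a cube of generation `n`
mass at most a constant times `s_n ^ (α (L - M - 1) / L)`.  By the mass distribution principle
their dimension is at least `α (L - M - 1) / L`, and `M` does not depend on `L`.
-/

noncomputable section

namespace CantorPV

/-! ### Addresses and cylinders -/

/-- The law of a sequence of independent uniform digits in `{0,1}^d`. -/
def digitMeasure (d : ℕ) : Measure (ℕ → Fin d → Bool) :=
  Measure.infinitePi fun _ : ℕ => (PMF.uniformOfFintype (Fin d → Bool)).toMeasure

instance (d : ℕ) : IsProbabilityMeasure (digitMeasure d) := by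
  unfold digitMeasure; infer_instance

/-- The cylinder of the sequences whose first `n` digits are those of `ω`. -/
def cyl {d : ℕ} (n : ℕ) (ω : ℕ → Fin d → Bool) : Set (ℕ → Fin d → Bool) :=
  {η | ∀ k < n, η k = ω k}

lemma mem_cyl {d : ℕ} {n : ℕ} {ω η : ℕ → Fin d → Bool} :
    η ∈ cyl n ω ↔ ∀ k < n, η k = ω k := Iff.rfl

lemma mem_cyl_self {d : ℕ} (n : ℕ) (ω : ℕ → Fin d → Bool) : ω ∈ cyl n ω := fun _ _ => rfl

lemma cyl_zero {d : ℕ} (ω : ℕ → Fin d → Bool) : cyl 0 ω = Set.univ := by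
  ext; simp [cyl]

lemma cyl_anti {d : ℕ} {m n : ℕ} (hmn : m ≤ n) (ω : ℕ → Fin d → Bool) : cyl n ω ⊆ cyl m ω :=
  fun _ hη k hk => hη k (hk.trans_le hmn)

lemma cyl_congr {d : ℕ} {n : ℕ} {ω ω' : ℕ → Fin d → Bool} (hω : ω' ∈ cyl n ω) :
    cyl n ω' = cyl n ω := by
  ext η
  exact forall₂_congr fun k hk => by rw [hω k hk]

lemma mem_cyl_succ {d : ℕ} {n : ℕ} {ω η : ℕ → Fin d → Bool} :
    η ∈ cyl (n + 1) ω ↔ η ∈ cyl n ω ∧ η n = ω n := by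
  simp only [mem_cyl, Nat.lt_succ_iff_lt_or_eq]
  constructor
  · exact fun h => ⟨fun k hk => h k (Or.inl hk), h n (Or.inr rfl)⟩
  · rintro ⟨h1, h2⟩ k (hk | rfl)
    exacts [h1 k hk, h2]

/-- A sequence in `cyl p ω` but not in `cyl m ω` leaves the branch of `ω` at a level in
`[p, m)`. -/
lemma exists_mem_shell {d : ℕ} {p m : ℕ} {ω η : ℕ → Fin d → Bool}
    (hη : η ∈ cyl p ω \ cyl m ω) :
    ∃ k ∈ Finset.Ico p m, η ∈ cyl k ω \ cyl (k + 1) ω := by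
  classical
  have hex : ∃ m, η ∉ cyl m ω := ⟨m, hη.2⟩
  obtain ⟨k, hk⟩ : ∃ k, Nat.find hex = k + 1 := by
    refine Nat.exists_eq_succ_of_ne_zero fun h0 => ?_
    have := Nat.find_spec hex
    rw [h0, cyl_zero] at this
    exact this trivial
  have h1 : η ∈ cyl k ω := by
    by_contra hcon
    have := Nat.find_min' hex hcon
    omega
  have h2 : η ∉ cyl (k + 1) ω := hk ▸ Nat.find_spec hex
  refine ⟨k, Finset.mem_Ico.2 ⟨?_, ?_⟩, h1, h2⟩
  · by_contra! hlt
    exact h2 (cyl_anti hlt _ hη.1)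
  · have := Nat.find_min' hex hη.2
    omega

lemma measurableSet_cyl {d : ℕ} (n : ℕ) (ω : ℕ → Fin d → Bool) : MeasurableSet (cyl n ω) := by
  have : cyl n ω = ⋂ k, ⋂ _ : k < n, (fun η : ℕ → Fin d → Bool => η k) ⁻¹' {ω k} := by
    ext; simp [cyl]
  rw [this]
  exact MeasurableSet.iInter fun k => MeasurableSet.iInter fun _ =>
    measurable_pi_apply k (measurableSet_singleton _)

/-- The probability that the digits at the positions in a finite set take prescribed values. -/
lemma digitMeasure_forall_mem (d : ℕ) (s : Finset ℕ) (w : ℕ → Fin d → Bool) :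
    digitMeasure d {η | ∀ k ∈ s, η k = w k} = ((2 : ENNReal) ^ (d * s.card))⁻¹ := by
  have : {η : ℕ → Fin d → Bool | ∀ k ∈ s, η k = w k} = Set.pi (s : Set ℕ) fun k => {w k} := by
    ext; simp [Set.mem_pi]
  rw [this, digitMeasure, Measure.infinitePi_pi _ (fun k _ => measurableSet_singleton _)]
  simp only [PMF.toMeasure_apply_singleton _ _ (measurableSet_singleton _),
    PMF.uniformOfFintype_apply, Finset.prod_const]
  rw [← ENNReal.inv_pow]
  simp [pow_mul]

lemma digitMeasure_cyl (d n : ℕ) (ω : ℕ → Fin d → Bool) :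
    digitMeasure d (cyl n ω) = ((2 : ENNReal) ^ (d * n))⁻¹ := by
  have := digitMeasure_forall_mem d (Finset.range n) ω
  simpa [cyl] using this

lemma digitMeasure_real_cyl (d n : ℕ) (ω : ℕ → Fin d → Bool) :
    (digitMeasure d).real (cyl n ω) = ((2 : ℝ) ^ (d * n))⁻¹ := by
  simp [Measure.real, digitMeasure_cyl]

/-! ### Geometry of the cubes -/

lemma wordCorner_congr {d : ℕ} {lam : ℕ → ℝ} {n : ℕ} {ω ω' : ℕ → Fin d → Bool}
    (hω : ω' ∈ cyl n ω) : wordCorner d lam ω' n = wordCorner d lam ω n := by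
  ext i
  simp only [wordCorner]
  exact Finset.sum_congr rfl fun k hk => by rw [hω k (Finset.mem_range.1 hk)]

lemma wordCorner_succ (d : ℕ) (lam : ℕ → ℝ) (ω : ℕ → Fin d → Bool) (n : ℕ) (i : Fin d) :
    wordCorner d lam ω (n + 1) i
      = wordCorner d lam ω n i + if ω n i then side lam n - side lam (n + 1) else 0 := by
  simp [wordCorner, Finset.sum_range_succ]

/-- The cube of generation `n` on the branch `ω`. -/
def branchCube {d : ℕ} (lam : ℕ → ℝ) (n : ℕ) (ω : ℕ → Fin d → Bool) :
    Set (EuclideanSpace ℝ (Fin d)) :=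
  cube (wordCorner d lam ω n) (side lam n)

section Geometry

variable {d : ℕ} {lam : ℕ → ℝ} (h : ∀ n, 1 ≤ n → 0 < lam n ∧ lam n < 1 / 2)

include h

lemma branchCube_anti {m n : ℕ} (hmn : m ≤ n) (ω : ℕ → Fin d → Bool) :
    branchCube lam n ω ⊆ branchCube lam m ω := by
  induction n, hmn using Nat.le_induction with
  | base => exact subset_rfl
  | succ n _ ih => exact (cube_anti h ω n).trans ih

lemma side_le_half_pow {m n : ℕ} (hmn : m ≤ n) :
    side lam n ≤ (1 / 2) ^ (n - m) * side lam m := by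
  induction n, hmn using Nat.le_induction with
  | base => simp
  | succ n hmn ih =>
    have := two_mul_side_succ_lt h n
    rw [Nat.succ_sub hmn, pow_succ]
    linarith

lemma coding_mem_branchCube {n : ℕ} {ω η : ℕ → Fin d → Bool} (hη : η ∈ cyl n ω) :
    coding d lam η ∈ branchCube lam n ω := by
  have := coding_mem h η n
  rwa [wordCorner_congr hη] at this

omit h in
lemma norm_sub_le_of_mem_branchCube {n : ℕ} (hs : 0 ≤ side lam n) {ω : ℕ → Fin d → Bool}
    {x y : EuclideanSpace ℝ (Fin d)} (hx : x ∈ branchCube lam n ω)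
    (hy : y ∈ branchCube lam n ω) : ‖y - x‖ ≤ √d * side lam n := by
  rw [EuclideanSpace.norm_eq]
  refine (Real.sqrt_le_left (by positivity)).2 ?_
  calc ∑ i, ‖(y - x) i‖ ^ 2 ≤ ∑ _i : Fin d, side lam n ^ 2 := by
        refine Finset.sum_le_sum fun i _ => ?_
        have h1 := hx i
        have h2 := hy i
        simp only [Set.mem_Icc] at h1 h2
        rw [Real.norm_eq_abs, sq_abs, PiLp.sub_apply, sq_le_sq, abs_of_nonneg hs, abs_le]
        constructor <;> linarith [h1.1, h1.2, h2.1, h2.2]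
    _ = (√d * side lam n) ^ 2 := by simp [mul_pow]

lemma separation_of_mem_shell {g : ℝ}
    (hg : ∀ n, g * side lam n ≤ side lam n - 2 * side lam (n + 1)) {k : ℕ}
    {ω η : ℕ → Fin d → Bool} {x : EuclideanSpace ℝ (Fin d)} (hx : x ∈ branchCube lam (k + 1) ω)
    (hη : η ∈ cyl k ω \ cyl (k + 1) ω) : g * side lam k ≤ ‖coding d lam η - x‖ := by
  have hne : η k ≠ ω k := fun heq => hη.2 (mem_cyl_succ.2 ⟨hη.1, heq⟩)
  obtain ⟨i, hi⟩ := Function.ne_iff.1 hne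
  refine le_trans ?_ (PiLp.norm_apply_le _ i)
  have h1 := hx i
  have h2 := coding_mem h η (k + 1) i
  simp only [Set.mem_Icc, wordCorner_succ, wordCorner_congr hη.1] at h1 h2
  have h3 := hg k
  rw [PiLp.sub_apply, Real.norm_eq_abs]
  cases hb : ω k i <;> cases hb' : η k i <;> simp [hb, hb'] at h1 h2 hi
  · exact le_trans (by linarith [h1.2, h2.1]) (le_abs_self _)
  · exact le_trans (by linarith [h1.1, h2.2]) (neg_le_abs _)

end Geometry

/-! ### Estimates for the Riesz kernel -/

section Kernel

variable {d : ℕ} {α : ℝ}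

lemma measurable_rieszKernel (α : ℝ) :
    Measurable (rieszKernel α : EuclideanSpace ℝ (Fin d) → EuclideanSpace ℝ (Fin d)) := by
  unfold rieszKernel
  fun_prop

lemma rieszKernel_apply (x : EuclideanSpace ℝ (Fin d)) (i : Fin d) :
    rieszKernel α x i = (‖x‖ ^ (1 + α))⁻¹ * x i := by
  simp [rieszKernel]

lemma norm_rieszKernel_le (hα : 0 < α) {r : ℝ} (hr : 0 < r) {x : EuclideanSpace ℝ (Fin d)}
    (hx : r ≤ ‖x‖) : ‖rieszKernel α x‖ ≤ r ^ (-α) := by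
  have hx0 : 0 < ‖x‖ := hr.trans_le hx
  have : ‖rieszKernel α x‖ = ‖x‖ ^ (-α) := by
    rw [rieszKernel, norm_smul, norm_inv, Real.norm_of_nonneg (by positivity),
      ← Real.rpow_neg hx0.le]
    nth_rewrite 2 [← Real.rpow_one ‖x‖]
    rw [← Real.rpow_add hx0]
    congr 1
    ring
  rw [this]
  exact Real.rpow_le_rpow_of_nonpos hr hx (by linarith)

/-- Bernoulli's inequality for negative exponents, in homogeneous form. -/
lemma inv_rpow_sub_inv_rpow_mul_le {p r t : ℝ} (hp : 0 ≤ p) (hr : 0 < r) (hrt : r ≤ t) :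
    ((r ^ p)⁻¹ - (t ^ p)⁻¹) * r ≤ p * (r ^ p)⁻¹ * (t - r) := by
  have ht : 0 < t := hr.trans_le hrt
  have hlog : Real.log (t / r) ≤ t / r - 1 := Real.log_le_sub_one_of_pos (by positivity)
  have hexp : 1 - p * (t / r - 1) ≤ ((t / r) ^ p)⁻¹ := by
    rw [← Real.rpow_neg (by positivity), Real.rpow_def_of_pos (by positivity)]
    have := Real.add_one_le_exp (Real.log (t / r) * -p)
    nlinarith
  have hmul : (t ^ p)⁻¹ = (r ^ p)⁻¹ * ((t / r) ^ p)⁻¹ := by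
    rw [← mul_inv, ← Real.mul_rpow hr.le (by positivity)]
    congr 2
    field_simp
  have hrp : 0 < (r ^ p)⁻¹ := by positivity
  rw [hmul]
  calc ((r ^ p)⁻¹ - (r ^ p)⁻¹ * ((t / r) ^ p)⁻¹) * r
      = ((r ^ p)⁻¹ * r) * (1 - ((t / r) ^ p)⁻¹) := by ring
    _ ≤ ((r ^ p)⁻¹ * r) * (p * (t / r - 1)) := by gcongr; linarith
    _ = p * (r ^ p)⁻¹ * (t - r) := by field_simp

lemma norm_rieszKernel_sub_le (hα : 0 < α) {r : ℝ} (hr : 0 < r)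
    {x y : EuclideanSpace ℝ (Fin d)} (hx : r ≤ ‖x‖) (hy : r ≤ ‖y‖) :
    ‖rieszKernel α x - rieszKernel α y‖ ≤ (2 + α) * (r ^ (1 + α))⁻¹ * ‖x - y‖ := by
  wlog hxy : ‖x‖ ≤ ‖y‖ generalizing x y
  · rw [norm_sub_rev, norm_sub_rev x]
    exact this hy hx (le_of_not_ge hxy)
  have hx0 : 0 < ‖x‖ := hr.trans_le hx
  have hy0 : 0 < ‖y‖ := hr.trans_le hy
  have hmono : (‖y‖ ^ (1 + α))⁻¹ ≤ (‖x‖ ^ (1 + α))⁻¹ := by gcongr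
  have hsplit : rieszKernel α x - rieszKernel α y
      = ((‖x‖ ^ (1 + α))⁻¹ - (‖y‖ ^ (1 + α))⁻¹) • x + (‖y‖ ^ (1 + α))⁻¹ • (x - y) := by
    simp only [rieszKernel, sub_smul, smul_sub]
    abel
  have h1 : ‖((‖x‖ ^ (1 + α))⁻¹ - (‖y‖ ^ (1 + α))⁻¹) • x‖
      ≤ (1 + α) * (‖x‖ ^ (1 + α))⁻¹ * ‖x - y‖ := by
    rw [norm_smul, Real.norm_of_nonneg (by linarith)]
    refine (inv_rpow_sub_inv_rpow_mul_le (by linarith) hx0 hxy).trans ?_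
    gcongr
    rw [norm_sub_rev]
    exact norm_sub_norm_le y x
  have h2 : ‖(‖y‖ ^ (1 + α))⁻¹ • (x - y)‖ ≤ (‖x‖ ^ (1 + α))⁻¹ * ‖x - y‖ := by
    rw [norm_smul, Real.norm_of_nonneg (by positivity)]
    gcongr
  rw [hsplit]
  calc _ ≤ (1 + α) * (‖x‖ ^ (1 + α))⁻¹ * ‖x - y‖ + (‖x‖ ^ (1 + α))⁻¹ * ‖x - y‖ :=
        (norm_add_le _ _).trans (add_le_add h1 h2)
    _ = (2 + α) * (‖x‖ ^ (1 + α))⁻¹ * ‖x - y‖ := by ring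
    _ ≤ _ := by gcongr

end Kernel

/-! ### Integrals over shells -/

section Shell

variable {d : ℕ}

/-- The function equal to the sum of the `B k` over the levels `k ∈ [p, m)` at which the
sequence still follows `ω`. -/
def shellMajorant (p m : ℕ) (ω : ℕ → Fin d → Bool) (B : ℕ → ℝ) (η : ℕ → Fin d → Bool) : ℝ :=
  ∑ k ∈ Finset.Ico p m, (cyl k ω).indicator (fun _ => B k) η

lemma integrable_shellMajorant (p m : ℕ) (ω : ℕ → Fin d → Bool) (B : ℕ → ℝ) :
    Integrable (shellMajorant p m ω B) (digitMeasure d) :=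
  integrable_finsetSum _ fun k _ => (integrable_const (B k)).indicator (measurableSet_cyl k ω)

lemma integral_shellMajorant (p m : ℕ) (ω : ℕ → Fin d → Bool) (B : ℕ → ℝ) :
    ∫ η, shellMajorant p m ω B η ∂digitMeasure d
      = ∑ k ∈ Finset.Ico p m, ((2 : ℝ) ^ (d * k))⁻¹ * B k := by
  unfold shellMajorant
  rw [integral_finsetSum _ fun k _ =>
    (integrable_const (B k)).indicator (measurableSet_cyl k ω)]
  refine Finset.sum_congr rfl fun k _ => ?_
  rw [integral_indicator (measurableSet_cyl k ω), setIntegral_const, digitMeasure_real_cyl,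
    smul_eq_mul]

lemma shellMajorant_nonneg {p m : ℕ} {ω : ℕ → Fin d → Bool} {B : ℕ → ℝ} (hB : ∀ k, 0 ≤ B k)
    (η : ℕ → Fin d → Bool) : 0 ≤ shellMajorant p m ω B η :=
  Finset.sum_nonneg fun k _ => Set.indicator_nonneg (fun _ _ => hB k) _

lemma le_shellMajorant {p m : ℕ} {ω : ℕ → Fin d → Bool} {B : ℕ → ℝ} (hB : ∀ k, 0 ≤ B k)
    {f : (ℕ → Fin d → Bool) → ℝ}
    (hf : ∀ k ∈ Finset.Ico p m, ∀ η ∈ cyl k ω \ cyl (k + 1) ω, |f η| ≤ B k)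
    {η : ℕ → Fin d → Bool} (hη : η ∈ cyl p ω \ cyl m ω) : |f η| ≤ shellMajorant p m ω B η := by
  obtain ⟨k, hk, hηk⟩ := exists_mem_shell hη
  refine (hf k hk η hηk).trans ?_
  unfold shellMajorant
  refine le_trans ?_ (Finset.single_le_sum
    (f := fun k => (cyl k ω).indicator (fun _ => B k) η)
    (fun j _ => Set.indicator_nonneg (fun _ _ => hB j) _) hk)
  simp [Set.indicator_of_mem hηk.1]

lemma abs_setIntegral_le_of_subset_shell {p m : ℕ} {ω : ℕ → Fin d → Bool} {B : ℕ → ℝ}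
    (hB : ∀ k, 0 ≤ B k) {f : (ℕ → Fin d → Bool) → ℝ}
    (hf : ∀ k ∈ Finset.Ico p m, ∀ η ∈ cyl k ω \ cyl (k + 1) ω, |f η| ≤ B k)
    {s : Set (ℕ → Fin d → Bool)} (hs : MeasurableSet s) (hsub : s ⊆ cyl p ω \ cyl m ω) :
    |∫ η in s, f η ∂digitMeasure d| ≤ ∑ k ∈ Finset.Ico p m, ((2 : ℝ) ^ (d * k))⁻¹ * B k := by
  rw [← integral_shellMajorant p m ω B, ← integral_indicator hs, ← Real.norm_eq_abs]
  refine norm_integral_le_of_norm_le (integrable_shellMajorant p m ω B) (ae_of_all _ fun η => ?_)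
  by_cases hη : η ∈ s
  · rw [Set.indicator_of_mem hη]
    exact le_shellMajorant hB hf (hsub hη)
  · rw [Set.indicator_of_notMem hη, norm_zero]
    exact shellMajorant_nonneg hB η

lemma integrableOn_shell {p m : ℕ} {ω : ℕ → Fin d → Bool} {B : ℕ → ℝ}
    (hB : ∀ k, 0 ≤ B k) {f : (ℕ → Fin d → Bool) → ℝ} (hfm : Measurable f)
    (hf : ∀ k ∈ Finset.Ico p m, ∀ η ∈ cyl k ω \ cyl (k + 1) ω, |f η| ≤ B k) :
    IntegrableOn f (cyl p ω \ cyl m ω) (digitMeasure d) := by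
  refine Integrable.mono' (integrable_shellMajorant p m ω B).integrableOn
    hfm.aestronglyMeasurable ?_
  exact (ae_restrict_iff' ((measurableSet_cyl p ω).diff (measurableSet_cyl m ω))).2
    (ae_of_all _ fun η hη => le_shellMajorant hB hf hη)

end Shell

/-- The `i`-th coordinate of the Riesz integral at `x` over the part of the Cantor set that leaves
the branch `ω` at a level in `[p, m)`, that is, over the cube of generation `p` minus the cube of
generation `m` on that branch. -/
def shellRiesz {d : ℕ} (α : ℝ) (lam : ℕ → ℝ) (i : Fin d) (p m : ℕ) (ω : ℕ → Fin d → Bool)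
    (x : EuclideanSpace ℝ (Fin d)) : ℝ :=
  ∫ η in cyl p ω \ cyl m ω, rieszKernel α (coding d lam η - x) i ∂digitMeasure d

section ShellRiesz

variable {d : ℕ} {α : ℝ} {lam : ℕ → ℝ} {g : ℝ}

lemma measurable_kernel_coding (h : ∀ n, 1 ≤ n → 0 < lam n ∧ lam n < 1 / 2)
    (x : EuclideanSpace ℝ (Fin d)) (i : Fin d) :
    Measurable fun η => rieszKernel α (coding d lam η - x) i := by
  have h1 := (measurable_rieszKernel α).comp ((measurable_coding h d).sub_const x)
  exact (by fun_prop : Measurable fun y : EuclideanSpace ℝ (Fin d) => y i).comp h1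

variable (h : ∀ n, 1 ≤ n → 0 < lam n ∧ lam n < 1 / 2) (hα : 0 < α) (hg0 : 0 < g)
  (hg : ∀ n, g * side lam n ≤ side lam n - 2 * side lam (n + 1))

include h hα hg0 hg

lemma abs_kernel_le_of_mem_shell {k m : ℕ} (hk : k < m) {ω η : ℕ → Fin d → Bool}
    {x : EuclideanSpace ℝ (Fin d)} (hx : x ∈ branchCube lam m ω)
    (hη : η ∈ cyl k ω \ cyl (k + 1) ω) (i : Fin d) :
    |rieszKernel α (coding d lam η - x) i| ≤ (g * side lam k) ^ (-α) := by
  rw [← Real.norm_eq_abs]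
  refine (PiLp.norm_apply_le _ i).trans (norm_rieszKernel_le hα (mul_pos hg0 (side_pos h k)) ?_)
  exact separation_of_mem_shell h hg (branchCube_anti h hk ω hx) hη

omit hα hg in
lemma shellMass_mul_kernelBound (k : ℕ) :
    ((2 : ℝ) ^ (d * k))⁻¹ * (g * side lam k) ^ (-α) = g ^ (-α) * density d α lam k := by
  rw [density, Real.mul_rpow hg0.le (side_pos h k).le]
  ring

lemma integrableOn_kernel_shell {p m : ℕ} {ω : ℕ → Fin d → Bool}
    {x : EuclideanSpace ℝ (Fin d)} (hx : x ∈ branchCube lam m ω) (i : Fin d) :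
    IntegrableOn (fun η => rieszKernel α (coding d lam η - x) i) (cyl p ω \ cyl m ω)
      (digitMeasure d) :=
  integrableOn_shell (B := fun k => (g * side lam k) ^ (-α))
    (fun k => Real.rpow_nonneg (mul_pos hg0 (side_pos h k)).le _) (measurable_kernel_coding h x i)
    fun _ hk _ hη => abs_kernel_le_of_mem_shell h hα hg0 hg (Finset.mem_Ico.1 hk).2 hx hη i

lemma abs_setIntegral_kernel_le {p m : ℕ} {ω : ℕ → Fin d → Bool}
    {x : EuclideanSpace ℝ (Fin d)} (hx : x ∈ branchCube lam m ω) (i : Fin d)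
    {s : Set (ℕ → Fin d → Bool)} (hs : MeasurableSet s) (hsub : s ⊆ cyl p ω \ cyl m ω) :
    |∫ η in s, rieszKernel α (coding d lam η - x) i ∂digitMeasure d|
      ≤ g ^ (-α) * ∑ k ∈ Finset.Ico p m, density d α lam k := by
  refine (abs_setIntegral_le_of_subset_shell (B := fun k => (g * side lam k) ^ (-α))
    (fun k => Real.rpow_nonneg (mul_pos hg0 (side_pos h k)).le _)
    (fun _ hk _ hη => abs_kernel_le_of_mem_shell h hα hg0 hg (Finset.mem_Ico.1 hk).2 hx hη i)
    hs hsub).trans_eq ?_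
  rw [Finset.mul_sum]
  exact Finset.sum_congr rfl fun k _ => shellMass_mul_kernelBound h hg0 k

lemma abs_shellRiesz_le {p m : ℕ} {ω : ℕ → Fin d → Bool}
    {x : EuclideanSpace ℝ (Fin d)} (hx : x ∈ branchCube lam m ω) (i : Fin d) :
    |shellRiesz α lam i p m ω x| ≤ g ^ (-α) * ∑ k ∈ Finset.Ico p m, density d α lam k :=
  abs_setIntegral_kernel_le h hα hg0 hg hx i
    ((measurableSet_cyl p ω).diff (measurableSet_cyl m ω)) subset_rfl

lemma shellRiesz_add {p m q : ℕ} (hpm : p ≤ m) (hmq : m ≤ q) {ω : ℕ → Fin d → Bool}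
    {x : EuclideanSpace ℝ (Fin d)} (hx : x ∈ branchCube lam q ω) (i : Fin d) :
    shellRiesz α lam i p q ω x = shellRiesz α lam i p m ω x + shellRiesz α lam i m q ω x := by
  unfold shellRiesz
  rw [← setIntegral_union]
  · congr 2
    ext η
    have h1 := @cyl_anti d p m hpm ω η
    have h2 := @cyl_anti d m q hmq ω η
    simp only [Set.mem_union, Set.mem_sdiff]
    tauto
  · exact Set.disjoint_left.2 fun η h1 h2 => h1.2 h2.1
  · exact (measurableSet_cyl m ω).diff (measurableSet_cyl q ω)
  · exact integrableOn_kernel_shell h hα hg0 hg (branchCube_anti h hmq ω hx) i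
  · exact integrableOn_kernel_shell h hα hg0 hg hx i

/-- Moving the base point inside the cube of generation `n` changes the contribution of the
complement of that cube by a geometrically weighted average of the densities. -/
lemma abs_shellRiesz_sub_le {n : ℕ} {ω : ℕ → Fin d → Bool}
    {x y : EuclideanSpace ℝ (Fin d)} (hx : x ∈ branchCube lam n ω)
    (hy : y ∈ branchCube lam n ω) (i : Fin d) :
    |shellRiesz α lam i 0 n ω x - shellRiesz α lam i 0 n ω y|
      ≤ (2 + α) * (g ^ (1 + α))⁻¹ * √d *
        ∑ k ∈ Finset.range n, (1 / 2) ^ (n - k) * density d α lam k := by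
  unfold shellRiesz
  rw [← integral_sub (integrableOn_kernel_shell h hα hg0 hg hx i)
    (integrableOn_kernel_shell h hα hg0 hg hy i)]
  have hpos : ∀ k, 0 < g * side lam k := fun k => mul_pos hg0 (side_pos h k)
  refine (abs_setIntegral_le_of_subset_shell
    (B := fun k => (2 + α) * ((g * side lam k) ^ (1 + α))⁻¹ * (√d * side lam n))
    (fun k => ?_) (fun k hk η hη => ?_)
    ((measurableSet_cyl 0 ω).diff (measurableSet_cyl n ω)) subset_rfl).trans ?_
  · have := hpos k
    have := (side_pos h n).le
    positivity
  · have hkn : k + 1 ≤ n := (Finset.mem_Ico.1 hk).2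
    rw [← PiLp.sub_apply, ← Real.norm_eq_abs]
    refine (PiLp.norm_apply_le _ i).trans ((norm_rieszKernel_sub_le hα (hpos k)
      (separation_of_mem_shell h hg (branchCube_anti h hkn ω hx) hη)
      (separation_of_mem_shell h hg (branchCube_anti h hkn ω hy) hη)).trans ?_)
    have := hpos k
    rw [sub_sub_sub_cancel_left]
    gcongr
    exact norm_sub_le_of_mem_branchCube (side_pos h n).le hx hy
  · rw [Finset.mul_sum, Finset.range_eq_Ico]
    refine Finset.sum_le_sum fun k hk => ?_
    have hkn := (Finset.mem_Ico.1 hk).2.le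
    have hs := side_pos h k
    have hle := side_le_half_pow h hkn
    have hkey : ((g * side lam k) ^ (1 + α))⁻¹ * side lam k
        = (g ^ (1 + α))⁻¹ * side lam k ^ (-α) := by
      rw [Real.mul_rpow hg0.le hs.le, Real.rpow_add hs, Real.rpow_one, Real.rpow_neg hs.le]
      field_simp
    calc ((2 : ℝ) ^ (d * k))⁻¹ *
          ((2 + α) * ((g * side lam k) ^ (1 + α))⁻¹ * (√d * side lam n))
        ≤ ((2 : ℝ) ^ (d * k))⁻¹ * ((2 + α) * ((g * side lam k) ^ (1 + α))⁻¹ *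
          (√d * ((1 / 2) ^ (n - k) * side lam k))) := by
          have := hpos k
          gcongr
      _ = (2 + α) * √d * (1 / 2) ^ (n - k) * ((2 : ℝ) ^ (d * k))⁻¹ *
          (((g * side lam k) ^ (1 + α))⁻¹ * side lam k) := by ring
      _ = _ := by rw [hkey, density]; ring

end ShellRiesz

/-! ### Runs of equal digits push the integral in one direction -/

section Drive

variable {d : ℕ} {α : ℝ} {lam : ℕ → ℝ} {g : ℝ}
  (h : ∀ n, 1 ≤ n → 0 < lam n ∧ lam n < 1 / 2) (hα : 0 < α) (hg0 : 0 < g)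
  (hg : ∀ n, g * side lam n ≤ side lam n - 2 * side lam (n + 1))

lemma wordCorner_eq_of_run {k q : ℕ} (hkq : k ≤ q) {ω : ℕ → Fin d → Bool} {i : Fin d}
    (hω : ∀ j, k ≤ j → j < q → ω j i = false) :
    wordCorner d lam ω q i = wordCorner d lam ω k i := by
  induction q, hkq using Nat.le_induction with
  | base => rfl
  | succ q hkq ih =>
    rw [wordCorner_succ, hω q hkq (by omega), ih fun j h1 h2 => hω j h1 (by omega)]
    simp

include h hα hg0 hg

/-- If the `i`-th digits of `ω` vanish at the levels in `[k, q)`, then `x` lies almost at the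
lower end of the cube of generation `k`.  The part of the shell on the opposite side then
contributes a multiple of the density, and the rest is negative by an exponentially small
amount at most. -/
lemma le_shellRiesz_of_run_single {k q m : ℕ} (hkq : k < q) (hqm : q ≤ m)
    {ω : ℕ → Fin d → Bool} {i : Fin d} (hω : ∀ j, k ≤ j → j < q → ω j i = false)
    {x : EuclideanSpace ℝ (Fin d)} (hx : x ∈ branchCube lam m ω) :
    ((2 : ℝ) ^ d)⁻¹ * (g * (√d ^ (1 + α))⁻¹) * density d α lam k
        - (g ^ (1 + α))⁻¹ * ((1 / 2) ^ (q - k) * density d α lam k)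
      ≤ shellRiesz α lam i k (k + 1) ω x := by
  have hxq : x ∈ branchCube lam q ω := branchCube_anti h hqm ω hx
  have hxk : x ∈ branchCube lam (k + 1) ω := branchCube_anti h hkq ω hxq
  have hs := side_pos h k
  have hd : 0 < √(d : ℝ) := Real.sqrt_pos.2 (Nat.cast_pos.2 i.pos)
  set f : (ℕ → Fin d → Bool) → ℝ := fun η => rieszKernel α (coding d lam η - x) i with hf
  set e : ℝ := (g ^ (1 + α))⁻¹ * ((1 / 2) ^ (q - k) * side lam k ^ (-α)) with he
  set c : ℝ := g * (√d ^ (1 + α))⁻¹ * side lam k ^ (-α) with hc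
  have hkey : side lam k ^ (-α) = (side lam k ^ (1 + α))⁻¹ * side lam k := by
    rw [Real.rpow_add hs, Real.rpow_one, Real.rpow_neg hs.le]
    field_simp
  have he0 : 0 ≤ e := by positivity
  -- the coordinate of `x` is within `s_q` of the lower end of the cube of generation `k`
  have hxi : x i ≤ wordCorner d lam ω k i + (1 / 2) ^ (q - k) * side lam k := by
    have h1 := (hxq i).2
    rw [wordCorner_eq_of_run hkq.le hω] at h1
    exact h1.trans (by gcongr; exact side_le_half_pow h hkq.le)
  have hlow : ∀ η ∈ cyl k ω \ cyl (k + 1) ω, 0 ≤ f η + e := by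
    intro η hη
    have hyi := (coding_mem_branchCube h hη.1 i).1
    have hsep := separation_of_mem_shell h hg hxk hη
    have hgs := mul_pos hg0 hs
    simp only [hf, rieszKernel_apply]
    rcases le_total 0 ((coding d lam η - x) i) with hu | hu
    · positivity
    have h1 : -((coding d lam η - x) i) ≤ (1 / 2) ^ (q - k) * side lam k := by
      rw [PiLp.sub_apply]
      linarith
    have h2 : (‖coding d lam η - x‖ ^ (1 + α))⁻¹ ≤ ((g * side lam k) ^ (1 + α))⁻¹ := by
      gcongr
    have h3 := mul_le_mul h2 h1 (by linarith) (by positivity)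
    have h4 : ((g * side lam k) ^ (1 + α))⁻¹ * ((1 / 2) ^ (q - k) * side lam k) = e := by
      rw [he, hkey, Real.mul_rpow hg0.le hs.le, mul_inv]
      ring
    linarith
  -- the sequences that choose the opposite corner at level `k`
  set ω' : ℕ → Fin d → Bool := Function.update ω k fun _ => true with hω'
  have hcyl : cyl k ω' = cyl k ω :=
    cyl_congr fun j hj => by simp [hω', Function.update_of_ne hj.ne]
  have hsub : cyl (k + 1) ω' ⊆ cyl k ω \ cyl (k + 1) ω := by
    intro η hη
    rw [mem_cyl_succ, hcyl] at hη
    refine ⟨hη.1, fun hcon => ?_⟩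
    have h1 : ω k i = true := by
      rw [← (mem_cyl_succ.1 hcon).2, hη.2]
      simp [hω']
    rw [hω k le_rfl hkq] at h1
    exact Bool.false_ne_true h1
  have hhigh : ∀ η ∈ cyl (k + 1) ω', c ≤ f η + e := by
    intro η hη
    have hηs := hsub hη
    have hyi := (coding_mem h η (k + 1) i).1
    have hηk : η k i = true := by rw [(mem_cyl_succ.1 hη).2]; simp [hω']
    rw [wordCorner_succ, wordCorner_congr hηs.1, hηk, if_pos rfl] at hyi
    have hx2 := (hxk i).2
    rw [wordCorner_succ, hω k le_rfl hkq] at hx2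
    simp only [Bool.false_eq_true, if_false] at hx2
    have hu : g * side lam k ≤ (coding d lam η - x) i := by
      rw [PiLp.sub_apply]
      linarith [hg k]
    have hpos : 0 < ‖coding d lam η - x‖ :=
      (mul_pos hg0 hs).trans_le (separation_of_mem_shell h hg hxk hηs)
    have hnorm : ‖coding d lam η - x‖ ≤ √d * side lam k :=
      norm_sub_le_of_mem_branchCube hs.le (branchCube_anti h (Nat.le_succ k) ω hxk)
        (coding_mem_branchCube h hηs.1)
    have h1 : ((√d * side lam k) ^ (1 + α))⁻¹ ≤ (‖coding d lam η - x‖ ^ (1 + α))⁻¹ := by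
      gcongr
    have h2 := mul_le_mul h1 hu (mul_pos hg0 hs).le (by positivity)
    have h3 : ((√d * side lam k) ^ (1 + α))⁻¹ * (g * side lam k) = c := by
      rw [hc, hkey, Real.mul_rpow hd.le hs.le, mul_inv]
      ring
    simp only [hf, rieszKernel_apply]
    linarith
  have hint : IntegrableOn f (cyl k ω \ cyl (k + 1) ω) (digitMeasure d) :=
    integrableOn_kernel_shell h hα hg0 hg hxk i
  have hint' : IntegrableOn (fun η => f η + e) (cyl k ω \ cyl (k + 1) ω) (digitMeasure d) :=
    hint.add (integrable_const e).integrableOn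
  have hmeas := (measurableSet_cyl k ω).diff (measurableSet_cyl (k + 1) ω)
  have h1 : c * ((2 : ℝ) ^ (d * (k + 1)))⁻¹
      ≤ ∫ η in cyl k ω \ cyl (k + 1) ω, (f η + e) ∂digitMeasure d := by
    rw [← digitMeasure_real_cyl d (k + 1) ω']
    refine (setIntegral_ge_of_const_le_real (measurableSet_cyl _ _) (measure_ne_top _ _) hhigh
      (hint'.mono_set hsub)).trans ?_
    exact setIntegral_mono_set hint' ((ae_restrict_iff' hmeas).2 (ae_of_all _ hlow))
      (LE.le.eventuallyLE hsub)
  rw [integral_add hint (integrable_const e).integrableOn, setIntegral_const, smul_eq_mul] at h1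
  have h2 : (digitMeasure d).real (cyl k ω \ cyl (k + 1) ω) ≤ ((2 : ℝ) ^ (d * k))⁻¹ := by
    rw [← digitMeasure_real_cyl d k ω]
    exact measureReal_mono Set.sdiff_subset
  have h3 := mul_le_mul_of_nonneg_right h2 he0
  have h4 : c * ((2 : ℝ) ^ (d * (k + 1)))⁻¹
      = ((2 : ℝ) ^ d)⁻¹ * (g * (√d ^ (1 + α))⁻¹) * density d α lam k := by
    rw [hc, density, mul_add, pow_add, mul_one, mul_inv]
    ring
  have h5 : ((2 : ℝ) ^ (d * k))⁻¹ * e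
      = (g ^ (1 + α))⁻¹ * ((1 / 2) ^ (q - k) * density d α lam k) := by
    rw [he, density]
    ring
  have h6 : shellRiesz α lam i k (k + 1) ω x
      = ∫ η in cyl k ω \ cyl (k + 1) ω, f η ∂digitMeasure d := rfl
  rw [h6, ← h4, ← h5]
  linarith

lemma shellRiesz_eq_sum {p q : ℕ} (hpq : p ≤ q) {ω : ℕ → Fin d → Bool}
    {x : EuclideanSpace ℝ (Fin d)} (hx : x ∈ branchCube lam q ω) (i : Fin d) :
    shellRiesz α lam i p q ω x
      = ∑ k ∈ Finset.Ico p q, shellRiesz α lam i k (k + 1) ω x := by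
  induction q, hpq using Nat.le_induction with
  | base => simp [shellRiesz]
  | succ q hpq ih =>
    rw [Finset.sum_Ico_succ_top hpq, ← ih (branchCube_anti h (Nat.le_succ q) ω hx)]
    exact shellRiesz_add h hα hg0 hg hpq (Nat.le_succ q) hx i

lemma le_shellRiesz_of_run (hanti : Antitone (density d α lam)) {n q m : ℕ} (hnq : n ≤ q)
    (hqm : q ≤ m) {ω : ℕ → Fin d → Bool} {i : Fin d}
    (hω : ∀ j, n ≤ j → j < q → ω j i = false)
    {x : EuclideanSpace ℝ (Fin d)} (hx : x ∈ branchCube lam m ω) :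
    ((2 : ℝ) ^ d)⁻¹ * (g * (√d ^ (1 + α))⁻¹) * (∑ k ∈ Finset.Ico n q, density d α lam k)
        - (g ^ (1 + α))⁻¹ * density d α lam n
      ≤ shellRiesz α lam i n q ω x := by
  rw [shellRiesz_eq_sum h hα hg0 hg hnq (branchCube_anti h hqm ω hx)]
  have hgeom : ∑ k ∈ Finset.Ico n q, (1 / 2 : ℝ) ^ (q - k) ≤ 1 := by
    have hle : ∑ k ∈ Finset.Ico n q, (1 / 2 : ℝ) ^ (q - k) = 1 - (1 / 2) ^ (q - n) := by
      clear hω hqm hx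
      induction q, hnq using Nat.le_induction with
      | base => simp
      | succ q hnq ih =>
        rw [Finset.sum_Ico_succ_top hnq, Nat.succ_sub hnq, pow_succ]
        have : ∑ k ∈ Finset.Ico n q, (1 / 2 : ℝ) ^ (q + 1 - k)
            = (1 / 2) * ∑ k ∈ Finset.Ico n q, (1 / 2 : ℝ) ^ (q - k) := by
          rw [Finset.mul_sum]
          refine Finset.sum_congr rfl fun k hk => ?_
          rw [Nat.succ_sub (Finset.mem_Ico.1 hk).2.le, pow_succ]
          ring
        rw [this, ih]
        simp
        ring
    rw [hle]
    have : (0 : ℝ) ≤ (1 / 2) ^ (q - n) := by positivity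
    linarith
  have ha0 : 0 ≤ density d α lam n := by
    have := side_pos h n
    unfold density
    positivity
  have herr : ∑ k ∈ Finset.Ico n q, (1 / 2 : ℝ) ^ (q - k) * density d α lam k
      ≤ density d α lam n := by
    calc _ ≤ ∑ k ∈ Finset.Ico n q, (1 / 2 : ℝ) ^ (q - k) * density d α lam n := by
          refine Finset.sum_le_sum fun k hk => ?_
          gcongr
          exact hanti (Finset.mem_Ico.1 hk).1
      _ ≤ 1 * density d α lam n := by rw [← Finset.sum_mul]; gcongr
      _ = _ := one_mul _
  have hsum := Finset.sum_le_sum fun k (hk : k ∈ Finset.Ico n q) =>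
    le_shellRiesz_of_run_single h hα hg0 hg (Finset.mem_Ico.1 hk).2 hqm
      (fun j h1 h2 => hω j ((Finset.mem_Ico.1 hk).1.trans h1) h2) hx
  rw [Finset.sum_sub_distrib, ← Finset.mul_sum, ← Finset.mul_sum] at hsum
  refine le_trans ?_ hsum
  gcongr

end Drive

/-! ### Reflections of the digits -/

/-- Exclusive or of all digits at the levels `≥ n` with `σ`: inside a cube of generation `n`, the
reflection in the coordinates `i` with `σ i = true`. -/
def flipFrom {d : ℕ} (n : ℕ) (σ : Fin d → Bool) (η : ℕ → Fin d → Bool) : ℕ → Fin d → Bool :=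
  fun k => if n ≤ k then fun i => xor (η k i) (σ i) else η k

lemma flipFrom_of_lt {d n k : ℕ} (hk : k < n) (σ : Fin d → Bool) (η : ℕ → Fin d → Bool) :
    flipFrom n σ η k = η k := if_neg hk.not_ge

lemma flipFrom_of_le {d n k : ℕ} (hk : n ≤ k) (σ : Fin d → Bool) (η : ℕ → Fin d → Bool)
    (i : Fin d) : flipFrom n σ η k i = xor (η k i) (σ i) := by
  simp [flipFrom, hk]

lemma flipFrom_mem_cyl {d n : ℕ} (σ : Fin d → Bool) (η : ℕ → Fin d → Bool) :
    flipFrom n σ η ∈ cyl n η := fun _ hk => flipFrom_of_lt hk σ η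

lemma flipFrom_preimage_cyl {d : ℕ} (n p : ℕ) (σ : Fin d → Bool) (ω : ℕ → Fin d → Bool) :
    flipFrom n σ ⁻¹' cyl p (flipFrom n σ ω) = cyl p ω := by
  ext η
  refine forall₂_congr fun k _ => ?_
  simp only [flipFrom]
  split_ifs
  · simp [funext_iff]
  · rfl

lemma measurable_flipFrom {d : ℕ} (n : ℕ) (σ : Fin d → Bool) : Measurable (flipFrom n σ) := by
  refine measurable_pi_iff.2 fun k => ?_
  by_cases hk : n ≤ k
  · simp only [flipFrom, hk, if_true]
    exact (measurable_of_finite fun v : Fin d → Bool => fun i => xor (v i) (σ i)).comp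
      (measurable_pi_apply k)
  · simp only [flipFrom, hk, if_false]
    exact measurable_pi_apply k

lemma map_flipFrom_digitMeasure {d : ℕ} (n : ℕ) (σ : Fin d → Bool) :
    (digitMeasure d).map (flipFrom n σ) = digitMeasure d := by
  have hmeas : ∀ f : (Fin d → Bool) → (Fin d → Bool), Measurable f :=
    fun f => measurable_of_finite f
  have hxor : Function.Involutive fun (v : Fin d → Bool) (i : Fin d) => xor (v i) (σ i) := by
    intro v; simp
  have hinv : ∀ f : (Fin d → Bool) → (Fin d → Bool), Function.Involutive f →
      (PMF.uniformOfFintype (Fin d → Bool)).toMeasure.map f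
        = (PMF.uniformOfFintype (Fin d → Bool)).toMeasure := by
    intro f hf
    refine Measure.ext_of_singleton fun a => ?_
    have : f ⁻¹' {a} = {f a} := by
      ext v
      simp only [Set.mem_preimage, Set.mem_singleton_iff]
      exact hf.eq_iff
    rw [Measure.map_apply (hmeas f) (measurableSet_singleton a), this]
    simp [PMF.toMeasure_apply_singleton _ _ (measurableSet_singleton _)]
  have := Measure.infinitePi_map_pi
    (μ := fun _ : ℕ => (PMF.uniformOfFintype (Fin d → Bool)).toMeasure)
    (f := fun k v => if n ≤ k then fun i => xor (v i) (σ i) else v) (fun _ => hmeas _)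
  unfold digitMeasure
  refine this.trans ?_
  congr 1
  funext k
  refine hinv _ ?_
  by_cases hk : n ≤ k
  · simpa [hk] using hxor
  · simp only [hk, if_false]
    exact fun _ => rfl

/-- The centre of the cube of generation `n` on the branch `ω`. -/
def centre {d : ℕ} (lam : ℕ → ℝ) (n : ℕ) (ω : ℕ → Fin d → Bool) : EuclideanSpace ℝ (Fin d) :=
  WithLp.toLp 2 fun i => wordCorner d lam ω n i + side lam n / 2

lemma centre_congr {d : ℕ} {lam : ℕ → ℝ} {n : ℕ} {ω ω' : ℕ → Fin d → Bool}
    (hω : ω' ∈ cyl n ω) : centre lam n ω' = centre lam n ω := by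
  simp [centre, wordCorner_congr hω]

section Reflection

variable {d : ℕ} {α : ℝ} {lam : ℕ → ℝ}

lemma wordCorner_flipFrom_of_false {n : ℕ} {σ : Fin d → Bool} {i : Fin d} (hσ : σ i = false)
    (ω : ℕ → Fin d → Bool) (m : ℕ) :
    wordCorner d lam (flipFrom n σ ω) m i = wordCorner d lam ω m i := by
  have : ∀ k, flipFrom n σ ω k i = ω k i := by
    intro k
    simp only [flipFrom]
    split_ifs <;> simp [hσ]
  simp [wordCorner, this]

lemma wordCorner_flipFrom_of_true {n m : ℕ} (hnm : n ≤ m) {σ : Fin d → Bool} {i : Fin d}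
    (hσ : σ i = true) (ω : ℕ → Fin d → Bool) :
    wordCorner d lam (flipFrom n σ ω) m i
      = 2 * wordCorner d lam ω n i + side lam n - side lam m - wordCorner d lam ω m i := by
  induction m, hnm using Nat.le_induction with
  | base => rw [wordCorner_congr (flipFrom_mem_cyl σ ω)]; ring
  | succ m hnm ih =>
    rw [wordCorner_succ, wordCorner_succ, ih, flipFrom_of_le hnm, hσ]
    cases ω m i <;> simp <;> ring

variable (h : ∀ n, 1 ≤ n → 0 < lam n ∧ lam n < 1 / 2)

include h

lemma centre_mem_branchCube (n : ℕ) (ω : ℕ → Fin d → Bool) :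
    centre lam n ω ∈ branchCube lam n ω := by
  intro i
  have := side_pos h n
  simp only [centre, Set.mem_Icc]
  constructor <;> linarith

lemma tendsto_wordCorner (ω : ℕ → Fin d → Bool) (i : Fin d) :
    Tendsto (fun m => wordCorner d lam ω m i) atTop (𝓝 (coding d lam ω i)) := by
  have hlow : Tendsto (fun m => coding d lam ω i - side lam m) atTop (𝓝 (coding d lam ω i)) := by
    simpa using tendsto_const_nhds.sub (side_tendsto h)
  refine tendsto_of_tendsto_of_tendsto_of_le_of_le hlow tendsto_const_nhds (fun m => ?_)
    (fun m => ?_)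
  · have := (coding_mem h ω m i).2
    dsimp only
    linarith
  · exact (coding_mem h ω m i).1

lemma coding_sub_centre_flipFrom {n m : ℕ} (hnm : n ≤ m) (σ : Fin d → Bool)
    {ω η : ℕ → Fin d → Bool} (hη : η ∈ cyl n ω) (i : Fin d) :
    (coding d lam (flipFrom n σ η) - centre lam m (flipFrom n σ ω)) i
      = (if σ i then -1 else 1) * (coding d lam η - centre lam m ω) i := by
  simp only [PiLp.sub_apply, centre]
  cases hσ : σ i
  · rw [wordCorner_flipFrom_of_false hσ, tendsto_nhds_unique
      ((tendsto_wordCorner h (flipFrom n σ η) i).congr fun m => wordCorner_flipFrom_of_false hσ η m)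
      (tendsto_wordCorner h η i)]
    simp
  · have h1 := tendsto_wordCorner h (flipFrom n σ η) i
    have h2 : Tendsto (fun m => 2 * wordCorner d lam η n i + side lam n - side lam m
        - wordCorner d lam η m i) atTop
        (𝓝 (2 * wordCorner d lam η n i + side lam n - 0 - coding d lam η i)) :=
      (tendsto_const_nhds.sub (side_tendsto h)).sub (tendsto_wordCorner h η i)
    have h3 := tendsto_nhds_unique (h1.congr' ((eventually_ge_atTop n).mono fun m hm =>
      wordCorner_flipFrom_of_true hm hσ η)) h2
    rw [h3, wordCorner_flipFrom_of_true hnm hσ, wordCorner_congr hη]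
    simp
    ring

/-- Reflecting the branch inside the cube of generation `n` reflects the integral, taken at the
centre of a smaller cube, over any shell inside that cube. -/
lemma shellRiesz_flipFrom {n p m : ℕ} (hnp : n ≤ p) (hpm : p ≤ m) (σ : Fin d → Bool)
    (ω : ℕ → Fin d → Bool) (i : Fin d) :
    shellRiesz α lam i p m (flipFrom n σ ω) (centre lam m (flipFrom n σ ω))
      = (if σ i then -1 else 1) * shellRiesz α lam i p m ω (centre lam m ω) := by
  have hmeas := (measurableSet_cyl p (flipFrom n σ ω)).diff (measurableSet_cyl m (flipFrom n σ ω))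
  unfold shellRiesz
  nth_rewrite 1 [← map_flipFrom_digitMeasure n σ]
  rw [setIntegral_map hmeas (measurable_kernel_coding h _ i).aestronglyMeasurable
    (measurable_flipFrom n σ).aemeasurable, Set.preimage_sdiff, flipFrom_preimage_cyl,
    flipFrom_preimage_cyl, ← integral_const_mul]
  refine setIntegral_congr_fun ((measurableSet_cyl p ω).diff (measurableSet_cyl m ω))
    fun η hη => ?_
  have hcoord := coding_sub_centre_flipFrom h (hnp.trans hpm) σ (cyl_anti hnp ω hη.1)
  have hnorm : ‖coding d lam (flipFrom n σ η) - centre lam m (flipFrom n σ ω)‖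
      = ‖coding d lam η - centre lam m ω‖ := by
    rw [EuclideanSpace.norm_eq, EuclideanSpace.norm_eq]
    congr 1
    refine Finset.sum_congr rfl fun j _ => ?_
    rw [hcoord j]
    split_ifs
    · rw [neg_one_mul, norm_neg]
    · rw [one_mul]
  simp only [rieszKernel_apply, hnorm, hcoord i]
  ring

end Reflection

/-! ### Geometrically weighted averages and a decreasing potential -/

/-- The weighted averages `b_0 = a_0`, `b_{n+1} = (b_n + a_n) / 2`. -/
def halfAverage (a : ℕ → ℝ) : ℕ → ℝ
  | 0 => a 0
  | n + 1 => (halfAverage a n + a n) / 2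

section HalfAverage

variable {a : ℕ → ℝ}

lemma sum_half_pow_mul_le_halfAverage (ha : ∀ n, 0 ≤ a n) (n : ℕ) :
    ∑ k ∈ Finset.range n, (1 / 2) ^ (n - k) * a k ≤ halfAverage a n := by
  induction n with
  | zero => simpa [halfAverage] using ha 0
  | succ n ih =>
    have : ∑ k ∈ Finset.range n, (1 / 2) ^ (n + 1 - k) * a k
        = (1 / 2) * ∑ k ∈ Finset.range n, (1 / 2) ^ (n - k) * a k := by
      rw [Finset.mul_sum]
      refine Finset.sum_congr rfl fun k hk => ?_
      rw [Nat.succ_sub (Finset.mem_range.1 hk).le, pow_succ]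
      ring
    rw [Finset.sum_range_succ, this, halfAverage, Nat.add_sub_cancel_left, pow_one]
    linarith

variable (hanti : Antitone a)

include hanti

lemma le_halfAverage (n : ℕ) : a n ≤ halfAverage a n := by
  induction n with
  | zero => exact le_rfl
  | succ n ih =>
    have := hanti (Nat.le_succ n)
    rw [halfAverage]
    linarith

lemma antitone_halfAverage : Antitone (halfAverage a) := by
  refine antitone_nat_of_succ_le fun n => ?_
  have := le_halfAverage hanti n
  rw [halfAverage]
  linarith

lemma tendsto_halfAverage (ha : Tendsto a atTop (𝓝 0)) :
    Tendsto (halfAverage a) atTop (𝓝 0) := by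
  have hnn : ∀ n, 0 ≤ halfAverage a n := fun n =>
    (hanti.le_of_tendsto ha n).trans (le_halfAverage hanti n)
  obtain ⟨l, hl⟩ : ∃ l, Tendsto (halfAverage a) atTop (𝓝 l) :=
    ⟨_, tendsto_atTop_ciInf (antitone_halfAverage hanti) ⟨0, by rintro _ ⟨n, rfl⟩; exact hnn n⟩⟩
  have h1 : Tendsto (fun n => halfAverage a (n + 1)) atTop (𝓝 ((l + 0) / 2)) :=
    (hl.add ha).div_const 2
  have h2 := tendsto_nhds_unique h1 (hl.comp (tendsto_add_atTop_nat 1))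
  rwa [show l = 0 by linarith] at hl

/-- Either the sum of `a` over a run of length `M` dominates the average at the start of the run,
or the average drops by half soon after it. -/
lemma halfAverage_le_half_of_sum_lt {A : ℝ} {M L n : ℕ} (hM0 : 0 < M) (hM : 4 * A ≤ M)
    (hML : M + 2 ≤ L) (hnn : ∀ n, 0 ≤ a n)
    (hsum : ∑ k ∈ Finset.Ico n (n + M), a k < A * halfAverage a n) :
    halfAverage a (n + L) ≤ halfAverage a n / 2 := by
  have hb0 : 0 ≤ halfAverage a n := (hnn n).trans (le_halfAverage hanti n)
  have hM0' : (0 : ℝ) < M := Nat.cast_pos.2 hM0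
  have h1 : (M : ℝ) * a (n + M) ≤ ∑ k ∈ Finset.Ico n (n + M), a k := by
    have := Finset.card_nsmul_le_sum (Finset.Ico n (n + M)) a (a (n + M))
      fun k hk => hanti (Finset.mem_Ico.1 hk).2.le
    simpa using this
  have h2 : a (n + M) ≤ halfAverage a n / 4 := by
    have : (M : ℝ) * a (n + M) ≤ M * (halfAverage a n / 4) := by nlinarith
    exact le_of_mul_le_mul_left this hM0'
  have h3 := hanti (Nat.le_succ (n + M))
  have h4 := antitone_halfAverage hanti (Nat.le_add_right n M)
  have h5 : halfAverage a (n + L) ≤ halfAverage a (n + M + 1 + 1) :=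
    antitone_halfAverage hanti (by omega)
  simp only [halfAverage, Nat.succ_eq_add_one] at h5 h3
  linarith

end HalfAverage

/-- A nonnegative sequence that loses at least `b j` at each step, as long as it exceeds a
sequence tending to `0`, tends to `0` when the total loss is infinite. -/
lemma tendsto_zero_of_le_max_sub {u b e : ℕ → ℝ} (hu : ∀ j, 0 ≤ u j) (hb : ∀ j, 0 ≤ b j)
    (hb' : ¬ Summable b) (he : Tendsto e atTop (𝓝 0))
    (hstep : ∀ j, u (j + 1) ≤ max (u j - b j) (e j)) : Tendsto u atTop (𝓝 0) := by
  rw [Metric.tendsto_atTop]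
  intro ε hε
  obtain ⟨J, hJ⟩ := (Metric.tendsto_atTop.1 he) (ε / 2) (by linarith)
  have heJ : ∀ j ≥ J, e j ≤ ε / 2 := fun j hj => by
    have := hJ j hj
    rw [Real.dist_0_eq_abs] at this
    exact (le_abs_self _).trans this.le
  obtain ⟨j₀, hj₀, hsmall⟩ : ∃ j ≥ J, u j ≤ ε / 2 := by
    by_contra! hcon
    refine hb' ((summable_nat_add_iff J).1 (summable_of_sum_range_le (c := u J)
      (fun j => hb _) fun n => ?_))
    suffices hsuff : ∑ j ∈ Finset.range n, b (j + J) ≤ u J - u (n + J) by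
      linarith [hu (n + J)]
    induction n with
    | zero => simp
    | succ n ih =>
      have h1 := hstep (n + J)
      have h2 := heJ (n + J) (by omega)
      have h3 := hcon (n + J + 1) (by omega)
      have h4 : u (n + J + 1) ≤ u (n + J) - b (n + J) := by
        rcases le_max_iff.1 h1 with h5 | h5
        · exact h5
        · linarith
      rw [Finset.sum_range_succ, show n + 1 + J = n + J + 1 by omega]
      linarith
  refine ⟨j₀, fun j hj => ?_⟩
  have hle : u j ≤ ε / 2 := by
    induction j, hj using Nat.le_induction with
    | base => exact hsmall
    | succ j hj ih =>
      refine (hstep j).trans (max_le ?_ (heJ j (hj₀.trans hj)))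
      linarith [hb j]
  rw [Real.dist_0_eq_abs, abs_of_nonneg (hu j)]
  linarith

/-! ### Steering a branch -/

/-- The `i`-th coordinate of the Riesz integral over the complement of the cube of generation `n`
on the branch `ω`, taken at the centre of that cube. -/
def centreRiesz {d : ℕ} (α : ℝ) (lam : ℕ → ℝ) (i : Fin d) (n : ℕ) (ω : ℕ → Fin d → Bool) : ℝ :=
  shellRiesz α lam i 0 n ω (centre lam n ω)

/-- The sequence that follows `ω` below the level `n`, vanishes on `[n, q]`, and follows `w`
above `q`. -/
def splice {d : ℕ} (n q : ℕ) (ω w : ℕ → Fin d → Bool) : ℕ → Fin d → Bool :=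
  fun k => if k < n then ω k else if k ≤ q then fun _ => false else w k

/-- The spliced sequence, reflected from the level `q` on so that the shells at the levels in
`[q, m)` contribute a nonnegative amount to each coordinate. -/
def alignedSplice {d : ℕ} (α : ℝ) (lam : ℕ → ℝ) (n q m : ℕ) (ω w : ℕ → Fin d → Bool) :
    ℕ → Fin d → Bool :=
  flipFrom q (fun i => decide (shellRiesz α lam i q m (splice n q ω w)
    (centre lam m (splice n q ω w)) < 0)) (splice n q ω w)

/-- The continuation of the branch `ω` of generation `n` up to the generation `m`, with free
digits `w` at the levels in `(q, m)`, in which all the contributions of the levels in `[n, m)`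
are reflected so as to oppose the integral accumulated up to the level `n`. -/
def steer {d : ℕ} (α : ℝ) (lam : ℕ → ℝ) (n q m : ℕ) (ω w : ℕ → Fin d → Bool) :
    ℕ → Fin d → Bool :=
  flipFrom n (fun i => decide (0 ≤ centreRiesz α lam i n ω)) (alignedSplice α lam n q m ω w)

section Steer

variable {d : ℕ} {α : ℝ} {lam : ℕ → ℝ} {g : ℝ}

lemma shellRiesz_congr {p m : ℕ} (hpm : p ≤ m) {ω ω' : ℕ → Fin d → Bool} (hω : ω' ∈ cyl m ω)
    (i : Fin d) (x : EuclideanSpace ℝ (Fin d)) :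
    shellRiesz α lam i p m ω' x = shellRiesz α lam i p m ω x := by
  rw [shellRiesz, shellRiesz, cyl_congr hω, cyl_congr (cyl_anti hpm ω hω)]

lemma centreRiesz_congr {n : ℕ} {ω ω' : ℕ → Fin d → Bool} (hω : ω' ∈ cyl n ω) (i : Fin d) :
    centreRiesz α lam i n ω' = centreRiesz α lam i n ω := by
  rw [centreRiesz, centreRiesz, centre_congr hω, shellRiesz_congr (Nat.zero_le n) hω]

lemma splice_mem_cyl {n q : ℕ} (ω w : ℕ → Fin d → Bool) : splice n q ω w ∈ cyl n ω :=
  fun k hk => by simp [splice, hk]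

lemma alignedSplice_mem_cyl {n q m : ℕ} (hnq : n ≤ q) (ω w : ℕ → Fin d → Bool) :
    alignedSplice α lam n q m ω w ∈ cyl n ω := fun k hk => by
  rw [alignedSplice, flipFrom_of_lt (hk.trans_le hnq), splice_mem_cyl ω w k hk]

lemma steer_mem_cyl {n q m : ℕ} (hnq : n ≤ q) (ω w : ℕ → Fin d → Bool) :
    steer α lam n q m ω w ∈ cyl n ω := fun k hk => by
  rw [steer, flipFrom_of_lt hk, alignedSplice_mem_cyl hnq ω w k hk]

/-- The free digits can be read off from the steered branch: the reflections act on all the levels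
in `[q, m)` alike, and the spliced digits at the level `q` vanish. -/
lemma eq_xor_steer {n q m k : ℕ} (hnq : n ≤ q) (hqk : q < k) (ω w : ℕ → Fin d → Bool)
    (i : Fin d) :
    w k i = xor (steer α lam n q m ω w k i) (steer α lam n q m ω w q i) := by
  have h1 : ¬ k < n := by omega
  have h2 : ¬ k ≤ q := by omega
  rw [steer, flipFrom_of_le (hnq.trans hqk.le), flipFrom_of_le hnq, alignedSplice,
    flipFrom_of_le hqk.le, flipFrom_of_le le_rfl]
  generalize decide (0 ≤ centreRiesz α lam i n ω) = s
  generalize decide (shellRiesz α lam i q m (splice n q ω w)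
    (centre lam m (splice n q ω w)) < 0) = t
  simp only [splice, h1, h2, hnq.not_gt, le_refl, if_true, if_false]
  cases w k i <;> cases s <;> cases t <;> rfl

lemma steer_congr {n q m : ℕ} (hqm : q ≤ m) {ω ω' w w' : ℕ → Fin d → Bool}
    (hω : ω' ∈ cyl n ω) (hw : w' ∈ cyl m w) :
    steer α lam n q m ω' w' ∈ cyl m (steer α lam n q m ω w) := by
  have hs : splice n q ω' w' ∈ cyl m (splice n q ω w) := by
    intro k hk
    simp only [splice]
    split_ifs with h1 h2
    exacts [hω k h1, rfl, hw k hk]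
  intro k hk
  simp only [steer, alignedSplice, flipFrom, hs k hk, centreRiesz_congr hω, centre_congr hs,
    shellRiesz_congr hqm hs]

variable (h : ∀ n, 1 ≤ n → 0 < lam n ∧ lam n < 1 / 2) (hα : 0 < α) (hg0 : 0 < g)
  (hg : ∀ n, g * side lam n ≤ side lam n - 2 * side lam (n + 1))
  (hanti : Antitone (density d α lam))

include h

lemma density_nonneg (n : ℕ) : 0 ≤ density d α lam n := by
  have := side_pos h n
  unfold density
  positivity

include hα hg0 hg

lemma abs_shellRiesz_sub_le_halfAverage {n : ℕ} {ω : ℕ → Fin d → Bool}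
    {x y : EuclideanSpace ℝ (Fin d)} (hx : x ∈ branchCube lam n ω)
    (hy : y ∈ branchCube lam n ω) (i : Fin d) :
    |shellRiesz α lam i 0 n ω x - shellRiesz α lam i 0 n ω y|
      ≤ (2 + α) * (g ^ (1 + α))⁻¹ * √d * halfAverage (density d α lam) n := by
  refine (abs_shellRiesz_sub_le h hα hg0 hg hx hy i).trans ?_
  gcongr
  exact sum_half_pow_mul_le_halfAverage (density_nonneg h) n

include hanti

lemma abs_shellRiesz_le_halfAverage {n m L : ℕ} (hnm : n ≤ m) (hmL : m ≤ n + L)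
    {ω : ℕ → Fin d → Bool} {x : EuclideanSpace ℝ (Fin d)} (hx : x ∈ branchCube lam m ω)
    (i : Fin d) :
    |shellRiesz α lam i n m ω x| ≤ g ^ (-α) * (L * halfAverage (density d α lam) n) := by
  refine (abs_shellRiesz_le h hα hg0 hg hx i).trans ?_
  have hnn := density_nonneg (d := d) (α := α) h n
  have hb := le_halfAverage hanti n
  gcongr
  calc ∑ k ∈ Finset.Ico n m, density d α lam k
      ≤ ∑ _k ∈ Finset.Ico n m, halfAverage (density d α lam) n :=
        Finset.sum_le_sum fun k hk => (hanti (Finset.mem_Ico.1 hk).1).trans hb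
    _ = ((m - n : ℕ) : ℝ) * halfAverage (density d α lam) n := by simp
    _ ≤ L * halfAverage (density d α lam) n := by
        have : m - n ≤ L := by omega
        gcongr
        exact hnn.trans hb

/-- One steering step moves each coordinate of the accumulated integral towards `0` by at least
the contribution of the run `[n, q)`, up to overshooting and up to the error made by moving the
base point. -/
lemma abs_centreRiesz_steer_le {n q m L : ℕ} (hnq : n ≤ q) (hqm : q ≤ m) (hmL : m ≤ n + L)
    (ω w : ℕ → Fin d → Bool) (i : Fin d) :
    |centreRiesz α lam i m (steer α lam n q m ω w)|
      ≤ max (|centreRiesz α lam i n ω|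
          - (((2 : ℝ) ^ d)⁻¹ * (g * (√d ^ (1 + α))⁻¹) *
              (∑ k ∈ Finset.Ico n q, density d α lam k)
            - (g ^ (1 + α))⁻¹ * halfAverage (density d α lam) n))
          (g ^ (-α) * (L * halfAverage (density d α lam) n))
        + (2 + α) * (g ^ (1 + α))⁻¹ * √d * halfAverage (density d α lam) n := by
  have hnm : n ≤ m := hnq.trans hqm
  set ω₀ := splice n q ω w with hω₀
  set ω₁ := alignedSplice α lam n q m ω w with hω₁
  set ω₂ := steer α lam n q m ω w with hω₂
  set b := halfAverage (density d α lam) n with hb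
  have hc₁ := centre_mem_branchCube h m ω₁
  have hc₂ := centre_mem_branchCube h m ω₂
  have hω₂n : ω₂ ∈ cyl n ω := steer_mem_cyl hnq ω w
  -- the levels in `[q, m)` contribute a nonnegative amount to the aligned sequence
  have hZ : 0 ≤ shellRiesz α lam i q m ω₁ (centre lam m ω₁) := by
    rw [hω₁, alignedSplice, shellRiesz_flipFrom h le_rfl hqm]
    split_ifs with hneg
    · have := of_decide_eq_true hneg
      linarith
    · have : ¬ _ := fun hlt => hneg (decide_eq_true hlt)
      linarith [not_lt.1 this]
  have hrun : ∀ j, n ≤ j → j < q → ω₁ j i = false := by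
    intro j h1 h2
    rw [hω₁, alignedSplice, flipFrom_of_lt h2]
    simp [splice, h1.not_gt, h2.le]
  have hdrive := le_shellRiesz_of_run h hα hg0 hg hanti hnq hqm hrun hc₁
  have hadd := shellRiesz_add h hα hg0 hg hnq hqm hc₁ i
  have hX := abs_shellRiesz_le_halfAverage h hα hg0 hg hanti hnm hmL hc₂ i
  have hflip : shellRiesz α lam i n m ω₂ (centre lam m ω₂)
      = (if decide (0 ≤ centreRiesz α lam i n ω) then -1 else 1)
        * shellRiesz α lam i n m ω₁ (centre lam m ω₁) := by
    rw [hω₂, steer, shellRiesz_flipFrom h le_rfl hnm]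
  have htot : centreRiesz α lam i m ω₂ = shellRiesz α lam i 0 n ω₂ (centre lam m ω₂)
      + shellRiesz α lam i n m ω₂ (centre lam m ω₂) :=
    shellRiesz_add h hα hg0 hg (Nat.zero_le n) hnm hc₂ i
  have hmove := abs_shellRiesz_sub_le_halfAverage h hα hg0 hg (branchCube_anti h hnm ω₂ hc₂)
    (centre_mem_branchCube h n ω₂) i
  have hcentre : shellRiesz α lam i 0 n ω₂ (centre lam n ω₂) = centreRiesz α lam i n ω :=
    centreRiesz_congr hω₂n i
  rw [hcentre] at hmove
  have hC3 : (g ^ (1 + α))⁻¹ * density d α lam n ≤ (g ^ (1 + α))⁻¹ * b := by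
    have := le_halfAverage hanti n
    gcongr
  have hX1 := neg_le_of_abs_le hX
  have hX2 := le_of_abs_le hX
  set S := centreRiesz α lam i n ω
  set X := shellRiesz α lam i n m ω₂ (centre lam m ω₂)
  set D := ((2 : ℝ) ^ d)⁻¹ * (g * (√d ^ (1 + α))⁻¹) *
    (∑ k ∈ Finset.Ico n q, density d α lam k) - (g ^ (1 + α))⁻¹ * b with hD
  have hbase : |S + X| ≤ max (|S| - D) (g ^ (-α) * (L * b)) := by
    rcases le_or_gt 0 S with hS | hS
    · rw [if_pos (decide_eq_true hS)] at hflip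
      rw [abs_of_nonneg hS]
      refine abs_le'.2 ⟨le_max_of_le_left ?_, le_max_of_le_right ?_⟩ <;> linarith
    · rw [if_neg (by simpa using hS)] at hflip
      rw [abs_of_neg hS]
      refine abs_le'.2 ⟨le_max_of_le_right ?_, le_max_of_le_left ?_⟩ <;> linarith
  rw [htot]
  calc _ = |(S + X) + (shellRiesz α lam i 0 n ω₂ (centre lam m ω₂) - S)| := by congr 1; ring
    _ ≤ _ := (abs_add_le _ _).trans (add_le_add hbase hmove)

/-- With runs of a fixed length `M`, a multiple of `halfAverage` added to the modulus of the
accumulated integral gives a potential to which `tendsto_zero_of_le_max_sub` applies. -/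
lemma exists_potential (hd : 0 < d) :
    ∃ M : ℕ, ∃ κ : ℝ, 0 ≤ κ ∧ ∀ L, M + 2 ≤ L → ∃ C : ℝ, ∀ (n : ℕ)
      (ω w : ℕ → Fin d → Bool) (i : Fin d),
      |centreRiesz α lam i (n + L) (steer α lam n (n + M) (n + L) ω w)|
          + κ * halfAverage (density d α lam) (n + L)
        ≤ max (|centreRiesz α lam i n ω| + κ * halfAverage (density d α lam) n
            - halfAverage (density d α lam) n)
          (C * halfAverage (density d α lam) n) := by
  have hd' : 0 < √(d : ℝ) := Real.sqrt_pos.2 (Nat.cast_pos.2 hd)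
  set c : ℝ := ((2 : ℝ) ^ d)⁻¹ * (g * (√d ^ (1 + α))⁻¹) with hc
  set C₂ : ℝ := (2 + α) * (g ^ (1 + α))⁻¹ * √d with hC₂
  set C₃ : ℝ := (g ^ (1 + α))⁻¹ with hC₃
  have hc0 : 0 < c := by positivity
  have hC₂0 : 0 ≤ C₂ := by positivity
  have hC₃0 : 0 ≤ C₃ := by positivity
  -- a run whose densities sum to at least `(C₂ + C₃ + 1) / c * b` beats all the errors; after any
  -- other run `b` is halved, and the weight `2 * (C₂ + C₃ + 1)` turns this into the same gain
  obtain ⟨M, hM⟩ := exists_nat_ge (max 1 (4 * ((C₂ + C₃ + 1) / c)))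
  have hM1 : (1 : ℝ) ≤ M := (le_max_left _ _).trans hM
  have hM0 : 0 < M := Nat.one_le_cast.1 hM1
  refine ⟨M, 2 * (C₂ + C₃ + 1), by positivity, fun L hL =>
    ⟨g ^ (-α) * L + C₂ + 2 * (C₂ + C₃ + 1), fun n ω w i => ?_⟩⟩
  have hstep := abs_centreRiesz_steer_le h hα hg0 hg hanti (Nat.le_add_right n M)
    (show n + M ≤ n + L by omega) le_rfl ω w i
  rw [← hc, ← hC₂, ← hC₃] at hstep
  have hmono := antitone_halfAverage hanti (Nat.le_add_right n L)
  have hb0 : 0 ≤ halfAverage (density d α lam) n :=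
    (density_nonneg h n).trans (le_halfAverage hanti n)
  have hhalf := halfAverage_le_half_of_sum_lt hanti hM0 ((le_max_right _ _).trans hM) hL
    (density_nonneg h) (n := n)
  set b := halfAverage (density d α lam) n
  set b' := halfAverage (density d α lam) (n + L)
  set S := |centreRiesz α lam i n ω|
  set Sum := ∑ k ∈ Finset.Ico n (n + M), density d α lam k
  rcases lt_or_ge Sum ((C₂ + C₃ + 1) / c * b) with hbad | hgood
  · have h1 := hhalf hbad
    have h0 : 0 ≤ c * Sum :=
      mul_nonneg hc0.le (Finset.sum_nonneg fun k _ => density_nonneg h k)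
    have h2 : (C₂ + C₃ + 1) * b' ≤ (C₂ + C₃ + 1) * (b / 2) := by gcongr
    have h3 : 0 ≤ C₂ * b := by positivity
    have h4 : 0 ≤ C₃ * b := by positivity
    rcases le_total (S - (c * Sum - C₃ * b)) (g ^ (-α) * (L * b)) with hle | hle
    · rw [max_eq_right hle] at hstep
      exact le_max_of_le_right (by linarith)
    · rw [max_eq_left hle] at hstep
      exact le_max_of_le_left (by linarith)
  · have h1 : (C₂ + C₃ + 1) * b ≤ c * Sum := by
      calc (C₂ + C₃ + 1) * b = c * ((C₂ + C₃ + 1) / c * b) := by field_simp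
        _ ≤ c * Sum := by gcongr
    have h2 : (C₂ + C₃ + 1) * b' ≤ (C₂ + C₃ + 1) * b := by gcongr
    rcases le_total (S - (c * Sum - C₃ * b)) (g ^ (-α) * (L * b)) with hle | hle
    · rw [max_eq_right hle] at hstep
      exact le_max_of_le_right (by linarith)
    · rw [max_eq_left hle] at hstep
      exact le_max_of_le_left (by linarith)

end Steer

/-- The branches obtained by steering successively over the blocks of levels `[jL, (j+1)L)`, in
which the first `M + 1` levels are used for steering and `η` supplies the digits at the others. -/
def steeredBranch {d : ℕ} (α : ℝ) (lam : ℕ → ℝ) (M L : ℕ) (η : ℕ → Fin d → Bool) :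
    ℕ → ℕ → Fin d → Bool
  | 0 => fun _ _ => false
  | j + 1 => steer α lam (j * L) (j * L + M) (j * L + L) (steeredBranch α lam M L η j) η

/-- The common limit of the branches `steeredBranch α lam M L η j`; a digit at a level `k` is
settled after `k + 1` blocks. -/
def steered {d : ℕ} (α : ℝ) (lam : ℕ → ℝ) (M L : ℕ) (η : ℕ → Fin d → Bool) :
    ℕ → Fin d → Bool :=
  fun k => steeredBranch α lam M L η (k + 1) k

section Steered

variable {d : ℕ} {α : ℝ} {lam : ℕ → ℝ} {g : ℝ} {M L : ℕ}

lemma steeredBranch_mem_cyl (η : ℕ → Fin d → Bool) {j j' : ℕ} (hj : j ≤ j') :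
    steeredBranch α lam M L η j' ∈ cyl (j * L) (steeredBranch α lam M L η j) := by
  induction j', hj using Nat.le_induction with
  | base => exact mem_cyl_self _ _
  | succ j' hj ih =>
    rw [← cyl_congr ih]
    exact cyl_anti (Nat.mul_le_mul_right L hj) _
      (steer_mem_cyl (Nat.le_add_right _ _) _ _)

lemma steered_mem_cyl (hL : 0 < L) (η : ℕ → Fin d → Bool) (j : ℕ) :
    steered α lam M L η ∈ cyl (j * L) (steeredBranch α lam M L η j) := by
  intro k hk
  rcases le_total j (k + 1) with hj | hj
  · exact steeredBranch_mem_cyl η hj k hk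
  · refine (steeredBranch_mem_cyl η hj k ?_).symm
    exact (Nat.lt_succ_self k).trans_le (Nat.le_mul_of_pos_right _ hL)

lemma steeredBranch_congr (hML : M ≤ L) {η η' : ℕ → Fin d → Bool} {j : ℕ}
    (hη : η' ∈ cyl (j * L) η) :
    steeredBranch α lam M L η' j ∈ cyl (j * L) (steeredBranch α lam M L η j) := by
  induction j with
  | zero => simp [mem_cyl]
  | succ j ih =>
    rw [Nat.succ_mul] at hη ⊢
    exact steer_congr (Nat.add_le_add_left hML _)
      (ih (cyl_anti (Nat.le_add_right _ _) _ hη)) hη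

lemma measurable_steered (hML : M ≤ L) (hL : 0 < L) :
    Measurable (steered (d := d) α lam M L) := by
  refine measurable_pi_iff.2 fun k => ?_
  -- the digit at the level `k` depends on finitely many digits of `η` only
  let ext : (Fin ((k + 1) * L) → Fin d → Bool) → ℕ → Fin d → Bool :=
    fun v j => if hj : j < (k + 1) * L then v ⟨j, hj⟩ else fun _ => false
  have hfac : (fun η => steered (d := d) α lam M L η k)
      = (fun v => steered α lam M L (ext v) k) ∘ fun η j => η j := by
    funext η
    refine steeredBranch_congr hML (fun j hj => ?_) k
      ((Nat.lt_succ_self k).trans_le (Nat.le_mul_of_pos_right _ hL))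
    simp [ext, hj]
  rw [hfac]
  exact (measurable_of_finite _).comp (measurable_pi_iff.2 fun j => measurable_pi_apply _)

lemma eq_xor_steered (hML : M < L) (η : ℕ → Fin d → Bool) {j k : ℕ}
    (hk : j * L + M < k) (hk' : k < (j + 1) * L) (i : Fin d) :
    η k i = xor (steered α lam M L η k i) (steered α lam M L η (j * L + M) i) := by
  have hmem := steered_mem_cyl (α := α) (lam := lam) (M := M) (by omega : 0 < L) η (j + 1)
  rw [hmem k hk', hmem _ (hk.trans hk')]
  exact eq_xor_steer (Nat.le_add_right _ _) hk _ _ i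

variable (h : ∀ n, 1 ≤ n → 0 < lam n ∧ lam n < 1 / 2) (hα : 0 < α) (hg0 : 0 < g)
  (hg : ∀ n, g * side lam n ≤ side lam n - 2 * side lam (n + 1))
  (hanti : Antitone (density d α lam))

include h hα hg0 hg hanti

/-- If the averages along the blocks are summable then so are the densities, and the integrals
converge along every branch. -/
lemma exists_tendsto_shellRiesz_of_summable (hL : 0 < L)
    (hsum : Summable fun j => halfAverage (density d α lam) (j * L)) (ω : ℕ → Fin d → Bool)
    (i : Fin d) :
    ∃ l, Tendsto (fun n => shellRiesz α lam i 0 n ω (coding d lam ω)) atTop (𝓝 l) := by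
  have hnn := density_nonneg (d := d) (α := α) h
  have hb0 : ∀ n, 0 ≤ halfAverage (density d α lam) n :=
    fun n => (hnn n).trans (le_halfAverage hanti n)
  have hblock : ∀ J, ∑ k ∈ Finset.range (J * L), density d α lam k
      ≤ L * ∑ j ∈ Finset.range J, halfAverage (density d α lam) (j * L) := by
    intro J
    induction J with
    | zero => simp
    | succ J ih =>
      rw [Nat.succ_mul, Finset.sum_range_add, Finset.sum_range_succ, mul_add]
      refine add_le_add ih ?_
      calc ∑ x ∈ Finset.range L, density d α lam (J * L + x)
          ≤ ∑ _x ∈ Finset.range L, halfAverage (density d α lam) (J * L) :=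
            Finset.sum_le_sum fun x _ =>
              (hanti (Nat.le_add_right _ _)).trans (le_halfAverage hanti _)
        _ = L * halfAverage (density d α lam) (J * L) := by simp
  have hsummable : Summable (density d α lam) := by
    refine summable_of_sum_range_le
      (c := L * ∑' j, halfAverage (density d α lam) (j * L)) hnn fun n => ?_
    calc ∑ k ∈ Finset.range n, density d α lam k
        ≤ ∑ k ∈ Finset.range (n * L), density d α lam k :=
          Finset.sum_le_sum_of_subset_of_nonneg
            (Finset.range_mono (Nat.le_mul_of_pos_right n hL)) fun k _ _ => hnn k
      _ ≤ _ := hblock n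
      _ ≤ _ := by
          gcongr
          exact hsum.sum_le_tsum _ fun j _ => hb0 _
  refine cauchySeq_tendsto_of_complete (cauchySeq_of_dist_le_of_summable
    (fun n => g ^ (-α) * density d α lam n) (fun n => ?_) (hsummable.mul_left _))
  have hx := coding_mem_branchCube h (mem_cyl_self (n + 1) ω)
  rw [shellRiesz_add h hα hg0 hg (Nat.zero_le n) (Nat.le_succ n) hx i, dist_comm, Real.dist_eq,
    add_sub_cancel_left]
  simpa using abs_shellRiesz_le h hα hg0 hg (p := n) hx i

/-- Along every steered branch the integrals over the complements of the cubes converge, if the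
blocks are long enough compared with the runs. -/
lemma exists_tendsto_shellRiesz_steered (hd : 0 < d)
    (ha : Tendsto (density d α lam) atTop (𝓝 0)) :
    ∃ M : ℕ, ∀ L, M + 2 ≤ L → ∀ (η : ℕ → Fin d → Bool) (i : Fin d),
      ∃ l, Tendsto (fun n => shellRiesz α lam i 0 n (steered α lam M L η)
        (coding d lam (steered α lam M L η))) atTop (𝓝 l) := by
  obtain ⟨M, κ, hκ, hM⟩ := exists_potential h hα hg0 hg hanti hd
  refine ⟨M, fun L hL η i => ?_⟩
  have hL0 : 0 < L := by omega
  by_cases hsum : Summable fun j => halfAverage (density d α lam) (j * L)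
  · exact exists_tendsto_shellRiesz_of_summable h hα hg0 hg hanti hL0 hsum _ i
  obtain ⟨C, hC⟩ := hM L hL
  set b := halfAverage (density d α lam) with hb
  set ω := steered α lam M L η
  have hb0 : ∀ n, 0 ≤ b n := fun n => (density_nonneg h n).trans (le_halfAverage hanti n)
  have hmulL : Tendsto (fun j => j * L) atTop atTop := tendsto_id.atTop_mul_const' hL0
  have hbj : Tendsto (fun j => b (j * L)) atTop (𝓝 0) :=
    (tendsto_halfAverage hanti ha).comp hmulL
  have hpot : Tendsto (fun j => |centreRiesz α lam i (j * L) (steeredBranch α lam M L η j)|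
      + κ * b (j * L)) atTop (𝓝 0) := by
    refine tendsto_zero_of_le_max_sub (fun j => ?_) (fun j => hb0 (j * L)) hsum
      (by simpa using hbj.const_mul C) fun j => ?_
    · have := hb0 (j * L)
      positivity
    · rw [Nat.succ_mul]
      exact hC (j * L) (steeredBranch α lam M L η j) η i
  refine ⟨0, squeeze_zero_norm (a := fun n =>
    (|centreRiesz α lam i (n / L * L) (steeredBranch α lam M L η (n / L))| + κ * b (n / L * L))
      + ((2 + α) * (g ^ (1 + α))⁻¹ * √d + g ^ (-α) * L) * b (n / L * L)) (fun n => ?_) ?_⟩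
  · set j := n / L
    have hjn : j * L ≤ n := Nat.div_mul_le_self n L
    have hnj : n ≤ j * L + L := (Nat.lt_div_mul_add hL0).le
    have hx : ∀ m, coding d lam ω ∈ branchCube lam m ω := fun m =>
      coding_mem_branchCube h (mem_cyl_self m ω)
    rw [shellRiesz_add h hα hg0 hg (Nat.zero_le _) hjn (hx n) i, Real.norm_eq_abs]
    have h1 := abs_shellRiesz_le_halfAverage h hα hg0 hg hanti hjn hnj (hx n) i
    have h2 := abs_shellRiesz_sub_le_halfAverage h hα hg0 hg (hx (j * L))
      (centre_mem_branchCube h (j * L) ω) i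
    have h3 : shellRiesz α lam i 0 (j * L) ω (centre lam (j * L) ω)
        = centreRiesz α lam i (j * L) (steeredBranch α lam M L η j) :=
      centreRiesz_congr (steered_mem_cyl hL0 η j) i
    rw [h3] at h2
    have h4 := hb0 (j * L)
    have h5 : 0 ≤ κ * b (j * L) := by positivity
    rw [← hb] at h1 h2
    set S := centreRiesz α lam i (j * L) (steeredBranch α lam M L η j)
    set T := shellRiesz α lam i 0 (j * L) ω (coding d lam ω)
    set U := shellRiesz α lam i (j * L) n ω (coding d lam ω)
    calc |T + U| = |S + (T - S) + U| := by rw [add_sub_cancel]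
      _ ≤ |S| + |T - S| + |U| := abs_add_three _ _ _
      _ ≤ _ := by linarith
  · have hdiv : Tendsto (fun n => n / L) atTop atTop := Nat.tendsto_div_const_atTop hL0.ne'
    simpa using (hpot.comp hdiv).add ((hbj.comp hdiv).const_mul
      ((2 + α) * (g ^ (1 + α))⁻¹ * √d + g ^ (-α) * L))

end Steered

/-! ### Truncation at balls and at cubes -/

section Truncation

variable {d : ℕ} {α : ℝ} {lam : ℕ → ℝ} {g : ℝ}
  (h : ∀ n, 1 ≤ n → 0 < lam n ∧ lam n < 1 / 2)

include h

lemma measurableSet_far (x : EuclideanSpace ℝ (Fin d)) (ε : ℝ) :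
    MeasurableSet {η | ε < ‖coding d lam η - x‖} :=
  measurableSet_lt measurable_const ((measurable_coding h d).sub_const x).norm

lemma truncatedRiesz_apply (hα : 0 < α) {ε : ℝ} (hε : 0 < ε) (x : EuclideanSpace ℝ (Fin d))
    (i : Fin d) :
    truncatedRiesz α (cantorMeasure d lam) ε x i
      = ∫ η in {η | ε < ‖coding d lam η - x‖}, rieszKernel α (coding d lam η - x) i
          ∂digitMeasure d := by
  have hcod := measurable_coding h d
  have hker : Measurable fun y : EuclideanSpace ℝ (Fin d) => rieszKernel α (y - x) :=
    (measurable_rieszKernel α).comp (measurable_id.sub_const x)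
  have hset : MeasurableSet {y : EuclideanSpace ℝ (Fin d) | ε < ‖y - x‖} :=
    measurableSet_lt measurable_const (measurable_id.sub_const x).norm
  have h1 : truncatedRiesz α (cantorMeasure d lam) ε x
      = ∫ η in {η | ε < ‖coding d lam η - x‖}, rieszKernel α (coding d lam η - x)
          ∂digitMeasure d :=
    setIntegral_map hset hker.aestronglyMeasurable hcod.aemeasurable
  have hint : IntegrableOn (fun η => rieszKernel α (coding d lam η - x))
      {η | ε < ‖coding d lam η - x‖} (digitMeasure d) := by
    refine Measure.integrableOn_of_bounded (M := ε ^ (-α)) (measure_ne_top _ _)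
      (hker.comp hcod).aestronglyMeasurable ?_
    exact (ae_restrict_iff' (measurableSet_far h x ε)).2
      (ae_of_all _ fun η hη => norm_rieszKernel_le hα hε (le_of_lt hη))
  rw [h1]
  exact ((EuclideanSpace.proj i : EuclideanSpace ℝ (Fin d) →L[ℝ] ℝ).integral_comp_comm hint).symm

variable (hα : 0 < α) (hg0 : 0 < g)
  (hg : ∀ n, g * side lam n ≤ side lam n - 2 * side lam (n + 1))

include hα hg0 hg

/-- The ball of radius `ε` about a point of the Cantor set is comparable with the cube containing
that point whose diameter is the first one below `ε`. -/
lemma abs_truncatedRiesz_sub_le {J n : ℕ} (hJ : √d * (1 / 2) ^ J < g) {ε : ℝ}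
    (hε1 : √d * side lam (n + 1) < ε) (hε2 : ε ≤ √d * side lam n) (ω : ℕ → Fin d → Bool)
    (i : Fin d) :
    |truncatedRiesz α (cantorMeasure d lam) ε (coding d lam ω) i
        - shellRiesz α lam i 0 (n + 1) ω (coding d lam ω)|
      ≤ g ^ (-α) * ∑ k ∈ Finset.Ico (n - J) (n + 1), density d α lam k := by
  have hs : ∀ k, 0 < side lam k := side_pos h
  have hε : 0 < ε := lt_of_le_of_lt (mul_nonneg (Real.sqrt_nonneg _) (hs (n + 1)).le) hε1
  set x := coding d lam ω with hx
  have hxm : ∀ m, x ∈ branchCube lam m ω := fun m => coding_mem_branchCube h (mem_cyl_self m ω)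
  set A := cyl 0 ω \ cyl (n + 1) ω
  set B := {η | ε < ‖coding d lam η - x‖} with hB
  have hBA : B ⊆ A := by
    intro η hη
    refine ⟨by simp [cyl_zero], fun hcon => ?_⟩
    have := norm_sub_le_of_mem_branchCube (hs (n + 1)).le (hxm (n + 1))
      (coding_mem_branchCube h hcon)
    have hη' : ε < ‖coding d lam η - x‖ := hη
    linarith
  have hsub : A \ B ⊆ cyl (n - J) ω \ cyl (n + 1) ω := by
    rintro η ⟨hηA, hηB⟩
    refine ⟨by_contra fun hcon => ?_, hηA.2⟩
    obtain ⟨k, hk, hηk⟩ := exists_mem_shell ⟨hηA.1, hcon⟩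
    have hkJ : k < n - J := (Finset.mem_Ico.1 hk).2
    have h1 := separation_of_mem_shell h hg (hxm (k + 1)) hηk
    have h2 : ‖coding d lam η - x‖ ≤ ε := not_lt.1 hηB
    have h3 := side_le_half_pow h (show k ≤ n by omega)
    have h4 : ((1 : ℝ) / 2) ^ (n - k) ≤ (1 / 2) ^ J :=
      pow_le_pow_of_le_one (by norm_num) (by norm_num) (by omega)
    have h5 : √d * side lam n ≤ √d * ((1 / 2) ^ J * side lam k) := by
      have := (hs k).le
      gcongr
      exact h3.trans (by gcongr)
    have h6 : √d * (1 / 2) ^ J * side lam k < g * side lam k := by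
      have := hs k
      gcongr
    linarith
  have hAm : MeasurableSet A := (measurableSet_cyl 0 ω).diff (measurableSet_cyl (n + 1) ω)
  have hBm : MeasurableSet B := measurableSet_far h x ε
  rw [truncatedRiesz_apply h hα hε, abs_sub_comm, shellRiesz, ← hB, ← setIntegral_sdiff hBm
    (integrableOn_kernel_shell h hα hg0 hg (hxm (n + 1)) i) hBA]
  exact abs_setIntegral_kernel_le h hα hg0 hg (hxm (n + 1)) i (hAm.diff hBm) hsub

lemma hasPrincipalValue_of_tendsto_shellRiesz (hd : 0 < d)
    (ha : Tendsto (density d α lam) atTop (𝓝 0)) (ω : ℕ → Fin d → Bool)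
    (hlim : ∀ i, ∃ l, Tendsto (fun n => shellRiesz α lam i 0 n ω (coding d lam ω)) atTop (𝓝 l)) :
    HasPrincipalValue α (cantorMeasure d lam) (coding d lam ω) := by
  choose l hl using hlim
  have hd' : 0 < √(d : ℝ) := Real.sqrt_pos.2 (Nat.cast_pos.2 hd)
  obtain ⟨J, hJ⟩ : ∃ J : ℕ, √(d : ℝ) * (1 / 2) ^ J < g := by
    obtain ⟨J, hJ⟩ := exists_pow_lt_of_lt_one (div_pos hg0 hd') (by norm_num : (1 / 2 : ℝ) < 1)
    exact ⟨J, by rwa [lt_div_iff₀' hd'] at hJ⟩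
  have hs := side_pos h
  have hsanti : Antitone (side lam) := antitone_nat_of_succ_le fun n => by
    have := two_mul_side_succ_lt h n
    linarith [hs (n + 1)]
  suffices hcoord : ∀ i, Tendsto
      (fun ε => truncatedRiesz α (cantorMeasure d lam) ε (coding d lam ω) i) (𝓝[>] 0)
      (𝓝 (l i)) from
    ⟨WithLp.toLp 2 l, ((PiLp.continuous_toLp 2 _).tendsto l).comp (tendsto_pi_nhds.2 hcoord)⟩
  intro i
  have herr : Tendsto (fun n => g ^ (-α) * ∑ k ∈ Finset.Ico (n - J) (n + 1), density d α lam k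
      + |shellRiesz α lam i 0 (n + 1) ω (coding d lam ω) - l i|) atTop (𝓝 0) := by
    have h1 : Tendsto (fun n => ∑ k ∈ Finset.Ico (n - J) (n + 1), density d α lam k) atTop
        (𝓝 0) := by
      have hreidx : ∀ᶠ n in atTop, ∑ r ∈ Finset.range (J + 1), density d α lam (n - J + r)
          = ∑ k ∈ Finset.Ico (n - J) (n + 1), density d α lam k := by
        filter_upwards [eventually_ge_atTop J] with n hn
        rw [Finset.sum_Ico_eq_sum_range, show n + 1 - (n - J) = J + 1 by omega]
      refine Tendsto.congr' hreidx ?_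
      have := tendsto_finsetSum (Finset.range (J + 1)) fun r _ =>
        ha.comp ((tendsto_add_atTop_nat r).comp (tendsto_sub_atTop_nat J))
      simpa using this
    have h2 : Tendsto (fun n => |shellRiesz α lam i 0 (n + 1) ω (coding d lam ω) - l i|) atTop
        (𝓝 0) := by
      have := (((hl i).comp (tendsto_add_atTop_nat 1)).sub_const (l i)).abs
      simpa using this
    simpa using (h1.const_mul (g ^ (-α))).add h2
  rw [Metric.tendsto_nhdsWithin_nhds]
  intro δ hδ
  obtain ⟨n₀, hn₀⟩ := eventually_atTop.1 (herr.eventually_lt_const hδ)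
  refine ⟨√d * side lam n₀, mul_pos hd' (hs n₀), fun {ε} hε hdist => ?_⟩
  have hε0 : 0 < ε := hε
  rw [Real.dist_0_eq_abs, abs_of_pos hε0] at hdist
  have hex : ∃ n, √d * side lam (n + 1) < ε := by
    have h1 : Tendsto (fun n => √d * side lam (n + 1)) atTop (𝓝 (√d * 0)) :=
      ((side_tendsto h).comp (tendsto_add_atTop_nat 1)).const_mul _
    rw [mul_zero] at h1
    exact (h1.eventually_lt_const hε0).exists
  classical
  obtain ⟨n, hn1, hn2⟩ : ∃ n, √d * side lam (n + 1) < ε ∧ ε ≤ √d * side lam n := by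
    refine ⟨Nat.find hex, Nat.find_spec hex, ?_⟩
    rcases Nat.eq_zero_or_pos (Nat.find hex) with h0 | h0
    · rw [h0]
      refine hdist.le.trans ?_
      gcongr
      exact hsanti (Nat.zero_le _)
    · have := Nat.find_min hex (m := Nat.find hex - 1) (by omega)
      rw [Nat.sub_add_cancel h0] at this
      exact not_lt.1 this
  have hnn₀ : n₀ ≤ n := by
    by_contra! hlt
    have h1 : √d * side lam n₀ ≤ √d * side lam (n + 1) := by
      gcongr
      exact hsanti hlt
    linarith
  rw [Real.dist_eq]
  calc _ ≤ _ := abs_sub_le _ (shellRiesz α lam i 0 (n + 1) ω (coding d lam ω)) _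
    _ ≤ _ := add_le_add_left (abs_truncatedRiesz_sub_le h hα hg0 hg hJ hn1 hn2 ω i) _
    _ < δ := hn₀ n hnn₀

end Truncation

/-! ### Dimension of the set of steered points -/

/-- The mass distribution principle. -/
lemma le_dimH_of_measure_le {X : Type*} [EMetricSpace X] [MeasurableSpace X] [BorelSpace X]
    (ν : Measure X) {γ C : ℝ} (hC : 0 < C) {ε : ENNReal} (hε : 0 < ε)
    (hν : ∀ s : Set X, Metric.ediam s ≤ ε → ν s ≤ ENNReal.ofReal C * Metric.ediam s ^ γ)
    (hγ : 0 ≤ γ) {E : Set X} (hE : ν E ≠ 0) : ENNReal.ofReal γ ≤ dimH E := by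
  have hC0 : ENNReal.ofReal C ≠ 0 := (ENNReal.ofReal_pos.2 hC).ne'
  have hle : (ENNReal.ofReal C)⁻¹ • ν ≤ μH[γ] := by
    refine Measure.le_hausdorffMeasure γ _ ε hε fun s hs => ?_
    rw [Measure.smul_apply, smul_eq_mul]
    calc (ENNReal.ofReal C)⁻¹ * ν s
        ≤ (ENNReal.ofReal C)⁻¹ * (ENNReal.ofReal C * Metric.ediam s ^ γ) := by
          gcongr
          exact hν s hs
      _ = Metric.ediam s ^ γ := by
          rw [← mul_assoc, ENNReal.inv_mul_cancel hC0 ENNReal.ofReal_ne_top, one_mul]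
  refine le_dimH_of_hausdorffMeasure_ne_zero (d := γ.toNNReal) ?_
  rw [Real.coe_toNNReal γ hγ]
  refine fun h0 => hE ?_
  have h1 := Measure.le_iff'.1 hle E
  rw [h0, Measure.smul_apply, smul_eq_mul, nonpos_iff_eq_zero, mul_eq_zero] at h1
  exact h1.resolve_left (ENNReal.inv_ne_zero.2 ENNReal.ofReal_ne_top)

section Dimension

variable {d : ℕ} {α : ℝ} {lam : ℕ → ℝ} {g : ℝ} {M L : ℕ}

/-- Each block has `L - M - 1` free levels, so steering costs a fixed number of digits per
block. -/
lemma digitMeasure_steered_cyl_le (hML : M < L) (j : ℕ) (ω : ℕ → Fin d → Bool) :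
    digitMeasure d {η | steered α lam M L η ∈ cyl (j * L) ω}
      ≤ ((2 : ENNReal) ^ (d * (j * (L - M - 1))))⁻¹ := by
  have hL : 0 < L := by omega
  set φ : ℕ × ℕ → ℕ := fun p => p.1 * L + (M + 1 + p.2) with hφ
  set s : Finset ℕ := (Finset.range j ×ˢ Finset.range (L - M - 1)).image φ with hs
  have hdiv : ∀ a r, r < L - M - 1 → φ (a, r) / L = a := by
    intro a r hr
    rw [hφ]
    dsimp only
    rw [add_comm, Nat.add_mul_div_right _ _ hL, Nat.div_eq_of_lt (by omega), zero_add]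
  have hcard : s.card = j * (L - M - 1) := by
    rw [hs, Finset.card_image_of_injOn, Finset.card_product, Finset.card_range, Finset.card_range]
    rintro ⟨a, r⟩ h1 ⟨a', r'⟩ h2 heq
    simp only [Finset.coe_product, Finset.coe_range, Set.mem_prod, Set.mem_Iio] at h1 h2
    have ha : a = a' := by rw [← hdiv a r h1.2, ← hdiv a' r' h2.2, heq]
    subst ha
    simp only [hφ] at heq
    exact Prod.ext rfl (by simp only; omega)
  rw [← hcard, ← digitMeasure_forall_mem d s
    fun k i => xor (ω k i) (ω (k / L * L + M) i)]
  refine measure_mono fun η hη k hk => ?_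
  obtain ⟨⟨a, r⟩, har, rfl⟩ := Finset.mem_image.1 hk
  simp only [Finset.mem_product, Finset.mem_range] at har
  have hη' : steered α lam M L η ∈ cyl (j * L) ω := hη
  have hlt : φ (a, r) < (a + 1) * L := by
    rw [Nat.succ_mul]
    simp only [hφ]
    omega
  have hle : (a + 1) * L ≤ j * L := Nat.mul_le_mul_right L har.1
  have hgt : a * L + M < φ (a, r) := by
    simp only [hφ]
    omega
  funext i
  rw [eq_xor_steered hML η hgt hlt i, hη' _ (hlt.trans_le hle),
    hη' _ ((hgt.trans hlt).trans_le hle), hdiv a r har.2]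

variable (h : ∀ n, 1 ≤ n → 0 < lam n ∧ lam n < 1 / 2)

include h

/-- Steered points closer to each other than the gaps of generation `n` share the first `n` digits,
so the image measure of a set of small diameter is at most the mass of one steered cylinder. -/
lemma map_steered_le_of_ediam_lt (hg0 : 0 < g)
    (hg : ∀ n, g * side lam n ≤ side lam n - 2 * side lam (n + 1)) (hML : M < L) (n : ℕ)
    {s : Set (EuclideanSpace ℝ (Fin d))}
    (hs : Metric.ediam s < ENNReal.ofReal (g * side lam n)) :
    (digitMeasure d).map (fun η => coding d lam (steered α lam M L η)) s
      ≤ ((2 : ENNReal) ^ (d * (n / L * (L - M - 1))))⁻¹ := by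
  have hmeas : Measurable fun η => coding d lam (steered α lam M L η) :=
    (measurable_coding h d).comp (measurable_steered hML.le (by omega))
  refine (measure_mono subset_closure).trans ?_
  rw [Measure.map_apply hmeas isClosed_closure.measurableSet]
  rcases Set.eq_empty_or_nonempty
    ((fun η => coding d lam (steered α lam M L η)) ⁻¹' closure s) with h0 | ⟨η₀, hη₀⟩
  · rw [h0, measure_empty]
    exact zero_le
  refine (measure_mono fun η hη => ?_).trans
    (digitMeasure_steered_cyl_le (α := α) (lam := lam) hML (n / L) (steered α lam M L η₀))
  by_contra hcon
  obtain ⟨k, hk, hηk⟩ := exists_mem_shell (p := 0) ⟨by simp [cyl_zero], hcon⟩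
  have hkn : k < n := (Finset.mem_Ico.1 hk).2.trans_le (Nat.div_mul_le_self n L)
  have h1 := separation_of_mem_shell h hg
    (coding_mem_branchCube h (mem_cyl_self (k + 1) _)) hηk
  have h2 : side lam n ≤ side lam k := by
    refine (side_le_half_pow h hkn.le).trans ?_
    have : ((1 : ℝ) / 2) ^ (n - k) ≤ 1 := pow_le_one₀ (by norm_num) (by norm_num)
    nlinarith [side_pos h k]
  have h3 := Metric.edist_le_ediam_of_mem (Set.mem_preimage.1 hη) (Set.mem_preimage.1 hη₀)
  rw [Metric.ediam_closure, edist_dist, dist_eq_norm] at h3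
  refine absurd (h3.trans_lt hs) (not_lt.2 (ENNReal.ofReal_le_ofReal ?_))
  exact le_trans (by gcongr) h1

/-- As `2^{-dn} ≤ s_n^α`, the mass of a steered cylinder is at most a power of the side, whose
exponent tends to `α` with the length of the blocks. -/
lemma inv_two_pow_block_le (hanti : Antitone (density d α lam)) (hML : M < L)
    (n : ℕ) :
    ((2 : ℝ) ^ (d * (n / L * (L - M - 1))))⁻¹
      ≤ 2 ^ (d * (L - M - 1)) * side lam n ^ (α * ((L - M - 1 : ℕ) / L : ℝ)) := by
  have hs := side_pos h n
  have hL : (0 : ℝ) < L := by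
    have : 0 < L := by omega
    exact_mod_cast this
  set K := L - M - 1
  have hdens : ((2 : ℝ) ^ (d * n))⁻¹ ≤ side lam n ^ α := by
    have h1 := hanti (Nat.zero_le n)
    simp only [density, side_zero, mul_zero, pow_zero, inv_one, Real.one_rpow, mul_one] at h1
    rwa [Real.rpow_neg hs.le, ← div_eq_mul_inv, div_le_one (by positivity)] at h1
  have hfloor : (n : ℝ) / L ≤ (n / L : ℕ) + 1 := by
    rw [div_le_iff₀ hL]
    have := Nat.lt_div_mul_add (a := n) (b := L) (by omega)
    have h2 : (n : ℝ) ≤ ((n / L * L + L : ℕ) : ℝ) := by exact_mod_cast this.le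
    push_cast at h2
    linarith
  rw [Real.rpow_mul hs.le]
  calc ((2 : ℝ) ^ (d * (n / L * K)))⁻¹ = (2 : ℝ) ^ (-(d * ((n / L : ℕ) * K) : ℝ)) := by
        rw [Real.rpow_neg (by norm_num), ← Real.rpow_natCast]
        push_cast
        rfl
    _ ≤ (2 : ℝ) ^ ((d * K : ℝ) + -(d * n : ℝ) * (K / L)) := by
        refine Real.rpow_le_rpow_of_exponent_le (by norm_num) ?_
        have h3 : (d : ℝ) * K * (n / L) ≤ d * K * ((n / L : ℕ) + 1) := by gcongr
        have h4 : -(d * n : ℝ) * (K / L) = -(d * K * (n / L)) := by ring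
        rw [h4]
        linarith
    _ = 2 ^ (d * K) * (((2 : ℝ) ^ (d * n))⁻¹) ^ (K / L : ℝ) := by
        have e1 : (2 : ℝ) ^ (d * K) = 2 ^ (d * K : ℝ) := by
          rw [← Real.rpow_natCast]
          push_cast
          rfl
        have e2 : ((2 : ℝ) ^ (d * n))⁻¹ = 2 ^ (-(d * n : ℝ)) := by
          rw [Real.rpow_neg (by norm_num), ← Real.rpow_natCast]
          push_cast
          rfl
        rw [e1, e2, ← Real.rpow_mul (by norm_num), ← Real.rpow_add (by norm_num)]
    _ ≤ _ := by gcongr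

/-- The points coded by steered sequences form a set of dimension at least
`α (L - M - 1) / L`. -/
lemma le_dimH_range_coding_steered (hα : 0 < α) (hg0 : 0 < g)
    (hg : ∀ n, g * side lam n ≤ side lam n - 2 * side lam (n + 1))
    (hanti : Antitone (density d α lam)) {lamMin : ℝ} (hMin0 : 0 < lamMin)
    (hMin : ∀ n, 1 ≤ n → lamMin ≤ lam n) (hML : M + 2 ≤ L)
    {E : Set (EuclideanSpace ℝ (Fin d))}
    (hE : ∀ η, coding d lam (steered α lam M L η) ∈ E) :
    ENNReal.ofReal (α * ((L - M - 1 : ℕ) / L : ℝ)) ≤ dimH E := by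
  have hmeas : Measurable fun η => coding d lam (steered α lam M L η) :=
    (measurable_coding h d).comp (measurable_steered (by omega) (by omega))
  set ν := (digitMeasure d).map fun η => coding d lam (steered α lam M L η) with hν
  have hK : 0 < L - M - 1 := by omega
  have hL : 0 < L := by omega
  have hK' : (0 : ℝ) < (L - M - 1 : ℕ) := by exact_mod_cast hK
  have hL' : (0 : ℝ) < L := by exact_mod_cast hL
  set γ : ℝ := α * ((L - M - 1 : ℕ) / L : ℝ) with hγ
  have hγ0 : 0 < γ := by positivity
  set C : ℝ := 2 ^ (d * (L - M - 1)) with hC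
  have hC0 : 0 < C := by positivity
  have hs := side_pos h
  have hbound : ∀ (s : Set (EuclideanSpace ℝ (Fin d))) (n : ℕ),
      Metric.ediam s < ENNReal.ofReal (g * side lam n) →
        ν s ≤ ENNReal.ofReal (C * side lam n ^ γ) := by
    intro s n hsn
    refine (map_steered_le_of_ediam_lt h hg0 hg (by omega) n hsn).trans ?_
    refine le_trans (le_of_eq ?_) (ENNReal.ofReal_le_ofReal
      (inv_two_pow_block_le h hanti (by omega : M < L) n))
    rw [ENNReal.ofReal_inv_of_pos (by positivity), ENNReal.ofReal_pow (by norm_num)]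
    norm_num
  have hνE : ν E ≠ 0 := by
    have h1 := Measure.le_map_apply (μ := digitMeasure d) hmeas.aemeasurable E
    have h2 : (fun η => coding d lam (steered α lam M L η)) ⁻¹' E = Set.univ :=
      Set.eq_univ_of_forall hE
    rw [h2, measure_univ] at h1
    exact (zero_lt_one.trans_le h1).ne'
  refine le_dimH_of_measure_le ν (C := C * ((g * lamMin) ^ γ)⁻¹) (by positivity)
    (ε := ENNReal.ofReal (g / 2)) (ENNReal.ofReal_pos.2 (by positivity)) (fun s hsε => ?_)
    hγ0.le hνE
  have hfin : Metric.ediam s ≠ ⊤ := (hsε.trans_lt ENNReal.ofReal_lt_top).ne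
  obtain ⟨r, hr0, hr⟩ : ∃ r : ℝ, 0 ≤ r ∧ Metric.ediam s = ENNReal.ofReal r :=
    ⟨_, ENNReal.toReal_nonneg, (ENNReal.ofReal_toReal hfin).symm⟩
  rcases hr0.eq_or_lt with rfl | hrpos
  · -- a set of diameter `0` lies in cylinders of every generation
    have hlim : Tendsto (fun n => ENNReal.ofReal (C * side lam n ^ γ)) atTop (𝓝 0) := by
      have h1 : Tendsto (fun n => C * side lam n ^ γ) atTop (𝓝 (C * 0 ^ γ)) :=
        ((side_tendsto h).rpow_const (Or.inr hγ0.le)).const_mul C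
      rw [Real.zero_rpow hγ0.ne', mul_zero] at h1
      simpa using ENNReal.tendsto_ofReal h1
    have h0 : ν s ≤ 0 := ge_of_tendsto' hlim fun n => hbound s n (by
      rw [hr]
      exact (ENNReal.ofReal_lt_ofReal_iff (mul_pos hg0 (hs n))).2 (mul_pos hg0 (hs n)))
    exact h0.trans zero_le
  · have hr1 : r < g * side lam 0 := by
      rw [hr, ENNReal.ofReal_le_ofReal_iff (by positivity)] at hsε
      rw [side_zero]
      linarith
    have hex : ∃ n, g * side lam (n + 1) ≤ r := by
      have h1 : Tendsto (fun n => g * side lam (n + 1)) atTop (𝓝 (g * 0)) :=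
        ((side_tendsto h).comp (tendsto_add_atTop_nat 1)).const_mul g
      rw [mul_zero] at h1
      exact (h1.eventually_le_const hrpos).exists
    classical
    obtain ⟨n, hn1, hn2⟩ : ∃ n, g * side lam (n + 1) ≤ r ∧ r < g * side lam n := by
      refine ⟨Nat.find hex, Nat.find_spec hex, ?_⟩
      rcases Nat.eq_zero_or_pos (Nat.find hex) with h0 | h0
      · rwa [h0]
      · have := Nat.find_min hex (m := Nat.find hex - 1) (by omega)
        rw [Nat.sub_add_cancel h0] at this
        exact not_le.1 this
    refine (hbound s n ?_).trans ?_
    · rw [hr]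
      exact (ENNReal.ofReal_lt_ofReal_iff (mul_pos hg0 (hs n))).2 hn2
    rw [hr, ENNReal.ofReal_rpow_of_nonneg hr0 hγ0.le, ← ENNReal.ofReal_mul (by positivity)]
    refine ENNReal.ofReal_le_ofReal ?_
    have hside : g * lamMin * side lam n ≤ r := by
      refine le_trans ?_ hn1
      rw [side_succ, mul_assoc, mul_comm (side lam n)]
      have := hMin (n + 1) (by omega)
      have := (hs n).le
      gcongr
    have hpow : (g * lamMin) ^ γ * side lam n ^ γ ≤ r ^ γ := by
      rw [← Real.mul_rpow (by positivity) (hs n).le]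
      have := (hs n).le
      gcongr
    have hpos : 0 < (g * lamMin) ^ γ := by positivity
    rw [mul_assoc]
    gcongr
    rwa [inv_mul_eq_div, le_div_iff₀' hpos]

end Dimension

lemma coding_mem_cantorSet {d : ℕ} {lam : ℕ → ℝ}
    (h : ∀ n, 1 ≤ n → 0 < lam n ∧ lam n < 1 / 2) (ω : ℕ → Fin d → Bool) :
    coding d lam ω ∈ cantorSet d lam :=
  Set.mem_iInter.2 fun n =>
    Set.mem_biUnion ⟨_, wordCorner_mem d lam ω n, rfl⟩ (coding_mem h ω n)

lemma antitone_density {d : ℕ} {α : ℝ} {lam : ℕ → ℝ} (hα : 0 < α)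
    (h : ∀ n, 1 ≤ n → 0 < lam n ∧ lam n < 1 / 2)
    (hlam : ∀ n, 1 ≤ n → (2 : ℝ) ^ (-(d : ℝ) / α) ≤ lam n) : Antitone (density d α lam) := by
  refine antitone_nat_of_succ_le fun n => ?_
  have hs := side_pos h n
  have hl := (h (n + 1) (by omega)).1
  have h1 : lam (n + 1) ^ (-α) ≤ 2 ^ d := by
    calc lam (n + 1) ^ (-α) ≤ ((2 : ℝ) ^ (-(d : ℝ) / α)) ^ (-α) :=
          Real.rpow_le_rpow_of_nonpos (by positivity) (hlam _ (by omega)) (by linarith)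
      _ = 2 ^ d := by
          rw [← Real.rpow_mul (by norm_num), ← Real.rpow_natCast]
          congr 1
          field_simp
  rw [density, density, side_succ, Real.mul_rpow hs.le hl.le, mul_add, pow_add, mul_one, mul_inv]
  calc ((2 : ℝ) ^ (d * n))⁻¹ * (2 ^ d)⁻¹ * (side lam n ^ (-α) * lam (n + 1) ^ (-α))
      ≤ ((2 : ℝ) ^ (d * n))⁻¹ * (2 ^ d)⁻¹ * (side lam n ^ (-α) * 2 ^ d) := by gcongr
    _ = _ := by field_simp

end CantorPV

end

theorem theorem1p2 (d : ℕ) (α : ℝ) (hα : 0 < α) (hαd : α < d)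
    (lam : ℕ → ℝ) (lamMax : ℝ) (hMax : lamMax < 1 / 2)
    (hlam : ∀ n : ℕ, 1 ≤ n → (2 : ℝ) ^ (-(d : ℝ) / α) ≤ lam n ∧ lam n ≤ lamMax)
    (ha : Tendsto (CantorPV.density d α lam) atTop (𝓝 0)) :
    ENNReal.ofReal α ≤ dimH {x ∈ CantorPV.cantorSet d lam |
        CantorPV.HasPrincipalValue α (CantorPV.cantorMeasure d lam) x} ∧
      (dimH (CantorPV.cantorSet d lam) = ENNReal.ofReal α →
        dimH {x ∈ CantorPV.cantorSet d lam |
          CantorPV.HasPrincipalValue α (CantorPV.cantorMeasure d lam) x} = ENNReal.ofReal α) := by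
  have hMin0 : 0 < (2 : ℝ) ^ (-(d : ℝ) / α) := by positivity
  have h : ∀ n, 1 ≤ n → 0 < lam n ∧ lam n < 1 / 2 := fun n hn =>
    ⟨hMin0.trans_le (hlam n hn).1, (hlam n hn).2.trans_lt hMax⟩
  have hd : 0 < d := Nat.cast_pos.1 (hα.trans hαd)
  have hg0 : 0 < 1 - 2 * lamMax := by linarith
  have hg : ∀ n, (1 - 2 * lamMax) * CantorPV.side lam n
      ≤ CantorPV.side lam n - 2 * CantorPV.side lam (n + 1) := fun n => by
    rw [CantorPV.side_succ]
    nlinarith [CantorPV.side_pos h n, (hlam (n + 1) (by omega)).2]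
  have hanti := CantorPV.antitone_density hα h fun n hn => (hlam n hn).1
  have hmain : ENNReal.ofReal α ≤ dimH {x ∈ CantorPV.cantorSet d lam |
      CantorPV.HasPrincipalValue α (CantorPV.cantorMeasure d lam) x} := by
    obtain ⟨M, hM⟩ :=
      CantorPV.exists_tendsto_shellRiesz_steered h hα hg0 hg hanti hd ha
    refine le_of_forall_lt_imp_le_of_dense fun c hc => ?_
    have hctop : c ≠ ⊤ := (hc.trans ENNReal.ofReal_lt_top).ne
    have hcα : c.toReal < α := by rwa [ENNReal.lt_ofReal_iff_toReal_lt hctop] at hc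
    obtain ⟨L₀, hL₀⟩ := exists_nat_ge (α * (M + 1) / (α - c.toReal))
    set L := max L₀ (M + 2) with hLdef
    have hL : M + 2 ≤ L := le_max_right _ _
    have hLpos : (0 : ℝ) < L := by
      have : 0 < L := by omega
      exact_mod_cast this
    have hLge : α * (M + 1) ≤ L * (α - c.toReal) := by
      rw [← div_le_iff₀ (by linarith)]
      exact hL₀.trans (by exact_mod_cast le_max_left _ _)
    have hcast : ((L - M - 1 : ℕ) : ℝ) = L - (M + 1) := by
      rw [Nat.sub_sub, Nat.cast_sub (by omega)]
      push_cast
      ring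
    refine le_trans ?_ (CantorPV.le_dimH_range_coding_steered h hα hg0 hg hanti hMin0
      (fun n hn => (hlam n hn).1) hL fun η =>
        ⟨CantorPV.coding_mem_cantorSet h _,
          CantorPV.hasPrincipalValue_of_tendsto_shellRiesz h hα hg0 hg hd ha _ (hM L hL η)⟩)
    rw [← ENNReal.ofReal_toReal hctop]
    refine ENNReal.ofReal_le_ofReal ?_
    rw [hcast, ← mul_div_assoc, le_div_iff₀ hLpos]
    linarith
  exact ⟨hmain, fun hK => le_antisymm ((dimH_mono fun x hx => hx.1).trans hK.le) hmain⟩
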